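/- Theorem 4.1 (Diamond–Erdős). Let $\mu$ be the Möbius function, $\Lambda$ the von Mangoldt function, $\psi(x)=\sum_{n\le x}\Lambda(n)$, $S(y)=\sum_{n\le y}\log n$, and $\pi(x)$ the number of primes $p\le x$. For a positive integer $T$ put $$\mu_T(n)=\begin{cases}\mu(n) & 1\le n<T,\\ -T\sum_{j<T}\mu(j)/j & n=T,\\ 0 & n>T.\end{cases}$$ For a finitely supported $a:\mathbb Z^{+}\to\mathbb R$, write $$F_a(x)=\sum_{d\le x}a(d)\,S(x/d),\qquad E_a(t)=\sum_{d\le t}a(d)\lfloor t/d\rfloor ,\qquad R_a(x)=\sum_{l\le x}\Lambda(l)\,|E_a(x/l)-1| ,$$ and let the error bound of Chebyshev's method with coefficients $a$ be $$\delta(a)=\limsup_{x\to\infty}\left|\frac{F_a(x)}{x}-1\right|+\limsup_{x\to\infty}\frac{R_a(x)}{x}.$$ For every $\varepsilon>0$ there is a positive integer $T=T(\varepsilon)$ such that Chebyshev's method with the coefficients $a=\mu_T$ determines $\pi(x)$ asymptotically up to a relative error less than $\varepsilon$, that is, all of the following hold: 1. $\displaystyle\sum_{d\le T}\frac{\mu_T(d)}{d}=0$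 and $\displaystyle\left|-\sum_{d\le T}\frac{\mu_T(d)\log d}{d}-1\right|<\varepsilon$; 2. $\displaystyle F_{\mu_T}(x)=-x\sum_{d\le T}\frac{\mu_T(d)\log d}{d}+O(\log x)$ as $x\to\infty$ (the implied constant may depend on $T$); 3. for all real $x\ge1$, $\displaystyle F_{\mu_T}(x)=\sum_{l\le x}\Lambda(l)\,E_{\mu_T}(x/l)$ and $|\psi(x)-x|\le|F_{\mu_T}(x)-x|+R_{\mu_T}(x)$; 4. $\displaystyle\limsup_{x\to\infty}\left|\frac{\pi(x)}{x/\log x}-1\right|\le\delta(\mu_T)<\varepsilon$, and hence $$\limsup_{x\to\infty}\left|\frac{\pi(x)}{x/\log x}-1\right|<\varepsilon .$$ -/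

import Mathlib

open Filter Asymptotics

noncomputable section

namespace ChebyshevMethod

/-- The truncated Möbius function `μ_T`: it is `μ n` for `n < T`, `-T * ∑_{j < T} μ j / j` at
`n = T`, and `0` for `n > T`. -/
def truncatedMoebius (T n : ℕ) : ℝ :=
  if n < T then (ArithmeticFunction.moebius n : ℝ)
  else if n = T then
    -(T : ℝ) * ∑ j ∈ Finset.Ico 1 T, (ArithmeticFunction.moebius j : ℝ) / (j : ℝ)
  else 0

/-- `S(y) = ∑_{n ≤ y} log n`. -/
def logSum (y : ℝ) : ℝ :=
  ∑ n ∈ Finset.Icc 1 ⌊y⌋₊, Real.log (n : ℝ)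

/-- Chebyshev's approximation `∑_{d ≤ x} a(d) S(x / d)` to `ψ(x)`, which is
`∑_{d ≤ x} μ(d) S(x / d)`. Terms with `d > x` would vanish, as `S(y) = 0` for `y < 1`. -/
def approxPsi (a : ℕ → ℝ) (x : ℝ) : ℝ :=
  ∑ d ∈ Finset.Icc 1 ⌊x⌋₊, a d * logSum (x / (d : ℝ))

/-- `E(t) = ∑_{d n ≤ t} a(d) = ∑_{d ≤ t} a(d) ⌊t / d⌋`. -/
def weightSum (a : ℕ → ℝ) (t : ℝ) : ℝ :=
  ∑ d ∈ Finset.Icc 1 ⌊t⌋₊, a d * (⌊t / (d : ℝ)⌋₊ : ℝ)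

/-- The remainder `∑_{l ≤ x} Λ(l) |E(x / l) - 1|` made by replacing each coefficient `E(x / l)` in
`∑_{l ≤ x} Λ(l) E(x / l)` by the coefficient `1` which it has in `ψ(x) = ∑_{l ≤ x} Λ(l)`. -/
def remainder (a : ℕ → ℝ) (x : ℝ) : ℝ :=
  ∑ l ∈ Finset.Icc 1 ⌊x⌋₊,
    ArithmeticFunction.vonMangoldt l * |weightSum a (x / (l : ℝ)) - 1|

/-- The asymptotic relative error that Chebyshev's method with coefficients `a` yields: the
limsup of `|∑_d a(d) S(x / d) / x - 1|` plus the limsup of the remainder divided by `x`.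
The limsups are taken in the extended reals, so they are `⊤` when the quantity is unbounded. -/
def errorBound (a : ℕ → ℝ) : EReal :=
  limsup (fun x : ℝ => ((|approxPsi a x / x - 1| : ℝ) : EReal)) atTop +
    limsup (fun x : ℝ => ((remainder a x / x : ℝ) : EReal)) atTop

/-- `limsup_{x → ∞} |π(x) / (x / log x) - 1|`, in the extended reals. -/
def primeCountingError : EReal :=
  limsup (fun x : ℝ =>
    ((|(Nat.primeCounting ⌊x⌋₊ : ℝ) / (x / Real.log x) - 1| : ℝ) : EReal)) atTop

end ChebyshevMethod

end

namespace ChebyshevMethod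

/-! ### A Tauberian theorem for Laplace transforms. -/

section Tauberian

open MeasureTheory Set Topology FourierTransform SchwartzMap

/-! Write M(N) = ∑_{d ≤ N} μ(d), m(x) = ∑_{d ≤ x} μ(d)/d and L(t) = ∑_{d ≤ e^t} (μ(d)/d)(t - log d).
The method works because L → 1, m → 0 and M(N) = o(N).

The coefficient of `truncatedMoebius` at T enforces ∑ a(d)/d = 0. By Stirling, F(x)/x then tends to
-∑ a(d) log d / d, which equals L(log T) and is close to 1 for large T. In the remainder, E(t) = 1
for 1 ≤ t < T. For T ≤ t ≤ KT, E(t) - 1 is a combination of about K differences of M and K copies of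
T m(T-1), hence a small multiple of T. For t > KT the bound |E(t) - 1| ≤ 3T suffices, since
Chebyshev's bound ψ(y) ≪ y makes the part l ≤ x/(KT) contribute O(x/K). Choosing K first and T
afterwards makes R(x)/x small (`remainder_truncatedMoebius_le`).

The analytic input is L → 1 (`tendsto_moebiusLogSum`). The Laplace transform of L - 1 is
1/(z²ζ(1+z)) - 1/z, which extends continuously to Re z ≥ 0 because ζ has no zero on Re s ≥ 1, and L
varies slowly, so `tendsto_zero_of_laplace` applies. Difference quotients of L give m → 0, and
partial summation gives M(N) = o(N). Passing from ψ to π is elementary. -/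

/-- The Fourier transform of φ serves as smoothing kernel. Compact support confines the frequencies
to a bounded range; φ(0) = 1 gives the kernel total mass one. -/
theorem exists_schwartz_hasCompactSupport_eq_one :
    ∃ φ : 𝓢(ℝ, ℂ), HasCompactSupport φ ∧ φ 0 = 1 := by
  let b : ContDiffBump (0 : ℝ) := ⟨1, 2, one_pos, one_lt_two⟩
  have hc : HasCompactSupport (fun x : ℝ => ((b x : ℝ) : ℂ)) :=
    b.hasCompactSupport.comp_left (g := fun x : ℝ => (x : ℂ)) (by simp)
  have hd : ContDiff ℝ (⊤ : ℕ∞) (fun x : ℝ => ((b x : ℝ) : ℂ)) :=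
    Complex.ofRealCLM.contDiff.comp b.contDiff
  refine ⟨hc.toSchwartzMap hd, hc, ?_⟩
  change ((b 0 : ℝ) : ℂ) = 1
  rw [b.one_of_mem_closedBall (by simp [b])]
  simp

theorem integral_fourier_eq_apply_zero (φ : 𝓢(ℝ, ℂ)) : ∫ s, 𝓕 (φ : ℝ → ℂ) s = φ 0 := by
  have h := φ.continuous.fourierInv_fourier_eq φ.integrable (𝓕 φ).integrable
  have h0 := congrFun h 0
  rw [Real.fourierInv_eq'] at h0
  simpa using h0

/-- Fubini's theorem for the Laplace transform against a kernel with compactly supported Fourier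
transform. -/
theorem integral_laplace_mul_fourier {G : ℝ → ℂ} {σ : ℝ}
    (hG : IntegrableOn (fun t : ℝ => G t * Complex.exp (-(σ * t))) (Ioi 0)) (φ : 𝓢(ℝ, ℂ))
    (r u : ℝ) :
    ∫ t in Ioi (0 : ℝ), G t * Complex.exp (-(σ * t)) * 𝓕 (φ : ℝ → ℂ) (r * (t - u)) =
      ∫ y : ℝ, Real.fourierChar (-(y * (-(r * u)))) •
        (φ y * ∫ t in Ioi (0 : ℝ),
          G t * Complex.exp (-((σ + (2 * Real.pi * r * y : ℝ) * Complex.I) * t))) := by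
  have e1 : ∀ t : ℝ, G t * Complex.exp (-(σ * t)) * 𝓕 (φ : ℝ → ℂ) (r * (t - u)) =
      ∫ y : ℝ, (G t * Complex.exp (-(σ * t))) * φ y *
        Complex.exp ((-(2 * Real.pi * y * (r * (t - u))) : ℝ) * Complex.I) := by
    intro t
    rw [Real.fourier_real_eq_integral_exp_smul, ← integral_const_mul]
    congr 1; ext y
    simp only [smul_eq_mul]
    rw [show (-2 * Real.pi * y * (r * (t - u))) = (-(2 * Real.pi * y * (r * (t - u)))) by ring]
    ring
  simp_rw [e1]
  rw [integral_integral_swap]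
  · congr 1; ext y
    rw [← integral_const_mul, Circle.smul_def, smul_eq_mul, ← integral_const_mul]
    congr 1; ext t
    rw [Real.fourierChar_apply]
    have : Complex.exp (-((σ + (2 * Real.pi * r * y : ℝ) * Complex.I) * t)) =
      Complex.exp (-(σ * t)) * Complex.exp (-((2 * Real.pi * r * y : ℝ) * Complex.I * t)) := by
      rw [← Complex.exp_add]; congr 1; ring
    have h2 : Complex.exp ((-(2 * Real.pi * y * (r * (t - u))) : ℝ) * Complex.I) =
      Complex.exp (-((2 * Real.pi * r * y : ℝ) * Complex.I * t)) *
      Complex.exp ((2 * Real.pi * -(y * -(r * u)) : ℝ) * Complex.I) := by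
      rw [← Complex.exp_add]; congr 1; push_cast; ring
    rw [this, h2]
    ring
  · have h : Integrable (fun p : ℝ × ℝ => (G p.1 * Complex.exp (-(σ * p.1))) * φ p.2)
      ((volume.restrict (Ioi 0)).prod volume) := Integrable.mul_prod hG φ.integrable
    refine h.mono (h.1.mul (Continuous.aestronglyMeasurable (by fun_prop))) ?_
    refine ae_of_all _ fun p => ?_
    simp only [Function.uncurry]
    rw [norm_mul, Complex.norm_exp_ofReal_mul_I, mul_one]

/-- The weight 1 + t² is the growth that slow variation permits, so this supplies the dominating
functions below. -/
theorem integrable_one_add_sq_mul_schwartz (K : 𝓢(ℝ, ℂ)) {c : ℝ} (hc : 0 ≤ c) (u : ℝ) :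
    Integrable fun s : ℝ => (1 + (u + c * s) ^ 2) * ‖K s‖ := by
  have h0 := K.integrable_pow_mul volume 0
  have h1 := K.integrable_pow_mul volume 1
  have h2 := K.integrable_pow_mul volume 2
  refine (((h0.const_mul (1 + u ^ 2 + |u|)).add (h1.const_mul (2 * |u| * c))).add
    (h2.const_mul (c ^ 2))).mono (Continuous.aestronglyMeasurable (by fun_prop)) ?_
  refine ae_of_all _ fun s => ?_
  rw [Real.norm_of_nonneg (by positivity)]
  refine le_trans ?_ (le_abs_self _)
  simp only [Pi.add_apply, Real.norm_eq_abs, sq_abs, pow_zero, pow_one, one_mul]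
  have : u * s ≤ |u| * |s| := by rw [← abs_mul]; exact le_abs_self _
  have h4 : c * (u * s) ≤ c * (|u| * |s|) := by gcongr
  have h5 : 0 ≤ |u| := abs_nonneg u
  calc (1 + (u + c * s) ^ 2) * ‖K s‖
      ≤ (1 + u ^ 2 + |u| + 2 * |u| * c * |s| + c ^ 2 * s ^ 2) * ‖K s‖ := by
        refine mul_le_mul_of_nonneg_right ?_ (norm_nonneg _)
        nlinarith
    _ = _ := by ring

theorem integrable_one_add_sq_mul_schwartz_comp (K : 𝓢(ℝ, ℂ)) {r : ℝ} (hr : 0 < r) (u : ℝ) :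
    Integrable fun t : ℝ => (1 + t ^ 2) * ‖K (r * (t - u))‖ := by
  have h := integrable_one_add_sq_mul_schwartz K (inv_pos.2 hr).le u
  have h' := (h.comp_mul_left' hr.ne').comp_sub_right u
  refine h'.congr (ae_of_all _ fun t => ?_)
  simp only
  rw [← mul_assoc, inv_mul_cancel₀ hr.ne']
  ring_nf


theorem integrableOn_mul_exp_of_le_sq {G : ℝ → ℂ} (hGc : Continuous G) {A : ℝ}
    (hGA : ∀ t, ‖G t‖ ≤ A * (1 + t ^ 2)) {z : ℂ} (hz : 0 < z.re) :
    IntegrableOn (fun t : ℝ => G t * Complex.exp (-(z * t))) (Ioi 0) := by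
  have h0 : IntegrableOn (fun t : ℝ => t ^ (0 : ℝ) * Real.exp (-z.re * t)) (Ioi 0) :=
    integrableOn_rpow_mul_exp_neg_mul_rpow (s := 0) (p := 1) (by norm_num) one_pos hz |>.congr_fun
      (fun t _ => by simp) measurableSet_Ioi
  have h2 : IntegrableOn (fun t : ℝ => t ^ (2 : ℝ) * Real.exp (-z.re * t)) (Ioi 0) :=
    integrableOn_rpow_mul_exp_neg_mul_rpow (s := 2) (p := 1) (by norm_num) one_pos hz |>.congr_fun
      (fun t _ => by simp) measurableSet_Ioi
  refine ((h0.add h2).const_mul A).mono' (Continuous.aestronglyMeasurable (by fun_prop)) ?_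
  refine ae_of_all _ fun t => ?_
  rw [norm_mul, Complex.norm_exp]
  simp only [Pi.add_apply, Real.rpow_zero, Real.rpow_two]
  have : (-(z * t)).re = -z.re * t := by simp
  rw [this]
  calc ‖G t‖ * Real.exp (-z.re * t)
      ≤ (A * (1 + t ^ 2)) * Real.exp (-z.re * t) :=
        mul_le_mul_of_nonneg_right (hGA t) (Real.exp_nonneg _)
    _ = _ := by ring

/-- Letting the real part tend to zero in the smoothed Laplace transform. -/
theorem integral_mul_fourier_eq {G : ℝ → ℂ} {H : ℂ → ℂ} (hGc : Continuous G) {A : ℝ}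
    (hGA : ∀ t, ‖G t‖ ≤ A * (1 + t ^ 2)) (hH : ContinuousOn H {z | 0 ≤ z.re})
    (hL : ∀ z : ℂ, 0 < z.re → ∫ t in Ioi (0 : ℝ), G t * Complex.exp (-(z * t)) = H z)
    {φ : 𝓢(ℝ, ℂ)} (hφ : HasCompactSupport φ) {r : ℝ} (hr : 0 < r) (u : ℝ) :
    ∫ t in Ioi (0 : ℝ), G t * 𝓕 (φ : ℝ → ℂ) (r * (t - u)) =
      ∫ y : ℝ, Real.fourierChar (-(y * (-(r * u)))) •
        (φ y * H ((2 * Real.pi * r * y : ℝ) * Complex.I)) := by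
  have hKint := integrable_one_add_sq_mul_schwartz_comp (𝓕 φ) hr u
  have hA : 0 ≤ A := by
    have := (norm_nonneg _).trans (hGA 0)
    simpa using this
  have hlim1 : Tendsto (fun σ : ℝ => ∫ t in Ioi (0 : ℝ),
      G t * Complex.exp (-(σ * t)) * 𝓕 (φ : ℝ → ℂ) (r * (t - u))) (𝓝[>] 0)
      (𝓝 (∫ t in Ioi (0 : ℝ), G t * 𝓕 (φ : ℝ → ℂ) (r * (t - u)))) := by
    have hKc : Continuous (𝓕 (φ : ℝ → ℂ)) := (𝓕 φ).continuous
    refine tendsto_integral_filter_of_dominated_convergence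
      (fun t => A * ((1 + t ^ 2) * ‖𝓕 φ (r * (t - u))‖)) ?_ ?_ (hKint.const_mul A).integrableOn ?_
    · exact Eventually.of_forall fun σ => Continuous.aestronglyMeasurable (by fun_prop)
    · filter_upwards [self_mem_nhdsWithin] with σ hσ
      refine (ae_restrict_iff' measurableSet_Ioi).2 (ae_of_all _ fun t ht => ?_)
      rw [norm_mul, norm_mul, Complex.norm_exp]
      have h1 : Real.exp (-(σ * t : ℂ)).re ≤ 1 := by
        rw [Real.exp_le_one_iff]
        simpa using mul_nonneg (le_of_lt hσ) (le_of_lt ht)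
      have h2 := hGA t
      calc ‖G t‖ * Real.exp (-(σ * t : ℂ)).re * ‖𝓕 (φ : ℝ → ℂ) (r * (t - u))‖
          ≤ (A * (1 + t ^ 2)) * 1 * ‖𝓕 (φ : ℝ → ℂ) (r * (t - u))‖ := by gcongr
        _ = _ := by rw [SchwartzMap.fourier_coe]; ring
    · refine ae_of_all _ fun t => ?_
      have : Continuous fun σ : ℝ =>
          G t * Complex.exp (-(σ * t)) * 𝓕 (φ : ℝ → ℂ) (r * (t - u)) := by fun_prop
      have := (this.tendsto 0).mono_left (nhdsWithin_le_nhds (s := Ioi 0))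
      simpa using this
  have hmaps : ∀ σ : ℝ, 0 ≤ σ → ∀ y : ℝ,
      (σ + (2 * Real.pi * r * y : ℝ) * Complex.I : ℂ) ∈ {z : ℂ | 0 ≤ z.re} := by
    intro σ hσ y
    simpa using hσ
  have hlim2 : Tendsto (fun σ : ℝ => ∫ y : ℝ, Real.fourierChar (-(y * (-(r * u)))) •
        (φ y * H (σ + (2 * Real.pi * r * y : ℝ) * Complex.I))) (𝓝[>] 0)
      (𝓝 (∫ y : ℝ, Real.fourierChar (-(y * (-(r * u)))) •
        (φ y * H ((2 * Real.pi * r * y : ℝ) * Complex.I)))) := by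
    -- Only frequencies in the support of φ matter, so a bound for H on a compact rectangle touching
    -- the imaginary axis is enough for domination.
    have hcomp : IsCompact ((fun p : ℝ × ℝ => (p.1 + (2 * Real.pi * r * p.2 : ℝ) * Complex.I : ℂ)) ''
        (Icc 0 1 ×ˢ tsupport φ)) :=
      (isCompact_Icc.prod hφ).image (by fun_prop)
    obtain ⟨B, hB⟩ := hcomp.exists_bound_of_continuousOn (f := H) (hH.mono (by
      rintro _ ⟨p, hp, rfl⟩
      exact hmaps _ hp.1.1 _))
    have hev : ∀ᶠ σ : ℝ in 𝓝[>] 0, σ ∈ Ioc (0 : ℝ) 1 := Ioc_mem_nhdsGT one_pos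
    refine tendsto_integral_filter_of_dominated_convergence (fun y => ‖φ y‖ * B) ?_ ?_
      (φ.integrable.norm.mul_const B) ?_
    · filter_upwards [hev] with σ hσ
      have : Continuous fun y : ℝ => H (σ + (2 * Real.pi * r * y : ℝ) * Complex.I) :=
        hH.comp_continuous (by fun_prop) (hmaps σ hσ.1.le)
      exact ((Real.continuous_fourierChar.comp (by fun_prop)).smul
        (φ.continuous.mul this)).aestronglyMeasurable
    · filter_upwards [hev] with σ hσ
      refine ae_of_all _ fun y => ?_
      rw [Circle.norm_smul, norm_mul]
      by_cases hy : φ y = 0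
      · simp [hy]
      · gcongr
        exact hB _ ⟨(σ, y), ⟨⟨hσ.1.le, hσ.2⟩, subset_tsupport _ hy⟩, rfl⟩
    · refine ae_of_all _ fun y => ?_
      refine Tendsto.const_smul (Tendsto.const_mul _ ?_) _
      have h1 := hH _ (hmaps 0 le_rfl y)
      simp only [Complex.ofReal_zero, zero_add] at h1
      refine h1.tendsto.comp (tendsto_nhdsWithin_iff.2 ⟨?_, ?_⟩)
      · have : Continuous fun σ : ℝ => (σ + (2 * Real.pi * r * y : ℝ) * Complex.I : ℂ) := by
          fun_prop
        have := (this.tendsto 0).mono_left (nhdsWithin_le_nhds (s := Ioi 0))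
        simpa using this
      · filter_upwards [hev] with σ hσ using hmaps σ hσ.1.le y
  refine tendsto_nhds_unique hlim1 (hlim2.congr' ?_)
  filter_upwards [self_mem_nhdsWithin] with σ hσ
  rw [integral_laplace_mul_fourier
    (integrableOn_mul_exp_of_le_sq hGc hGA (z := σ) (by simpa using hσ))]
  congr 1; ext y
  rw [← hL (σ + (2 * Real.pi * r * y : ℝ) * Complex.I) (by simpa using hσ)]

/-- A Tauberian theorem: a function of slow variation whose Laplace transform extends continuously
to the closed right half plane tends to zero. -/
theorem tendsto_zero_of_laplace {G : ℝ → ℂ} {H : ℂ → ℂ} {C : ℝ}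
    (hG : ∀ s t, ‖G t - G s‖ ≤ C * (|t - s| + |t - s| ^ 2))
    (hH : ContinuousOn H {z | 0 ≤ z.re})
    (hL : ∀ z : ℂ, 0 < z.re → ∫ t in Ioi (0 : ℝ), G t * Complex.exp (-(z * t)) = H z) :
    Tendsto G atTop (𝓝 0) := by
  have hC : 0 ≤ C := by
    have := (norm_nonneg _).trans (hG 0 1)
    norm_num at this
    linarith
  have hGc : Continuous G := by
    rw [continuous_iff_continuousAt]
    intro s
    rw [ContinuousAt, tendsto_iff_norm_sub_tendsto_zero]
    refine squeeze_zero (fun _ => norm_nonneg _) (fun t => hG s t) ?_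
    have : Continuous fun t : ℝ => C * (|t - s| + |t - s| ^ 2) := by fun_prop
    simpa using this.tendsto s
  obtain ⟨A, hA0, hA⟩ : ∃ A, 0 ≤ A ∧ ∀ t, ‖G t‖ ≤ A * (1 + t ^ 2) := by
    refine ⟨‖G 0‖ + 2 * C, by positivity, fun t => ?_⟩
    have h1 := hG 0 t
    have h2 := norm_le_norm_add_norm_sub (G 0) (G t)
    rw [norm_sub_rev] at h2
    simp only [sub_zero, sq_abs] at h1
    have h3 : |t| ≤ 1 + t ^ 2 :=
      abs_le.2 ⟨by nlinarith [sq_nonneg (t + 1)], by nlinarith [sq_nonneg (t - 1)]⟩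
    have h4 : C * |t| ≤ C * (1 + t ^ 2) := by gcongr
    nlinarith [norm_nonneg (G 0), sq_nonneg t, mul_nonneg (norm_nonneg (G 0)) (sq_nonneg t)]
  obtain ⟨φ, hφ, hφ0⟩ := exists_schwartz_hasCompactSupport_eq_one
  have hK1 : ∫ s, 𝓕 φ s = 1 := by
    rw [← hφ0, ← integral_fourier_eq_apply_zero]; rfl
  set K : 𝓢(ℝ, ℂ) := 𝓕 φ with hK
  have hKi1 := K.integrable_pow_mul volume 1
  have hKi2 := K.integrable_pow_mul volume 2
  set D : ℝ := C * ∫ s, (‖s‖ ^ 1 * ‖K s‖ + ‖s‖ ^ 2 * ‖K s‖) with hD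
  have hint : ∀ r : ℝ, 1 ≤ r → ∀ u : ℝ, Integrable fun s => G (u + r⁻¹ * s) * K s := by
    intro r hr u
    have hr0 : 0 < r := by linarith
    refine ((integrable_one_add_sq_mul_schwartz K (inv_pos.2 hr0).le u).const_mul A).mono'
      (Continuous.aestronglyMeasurable (by fun_prop)) (ae_of_all _ fun s => ?_)
    rw [norm_mul, ← mul_assoc]
    gcongr
    exact hA _
  -- Slow variation makes averaging at scale 1/r harmless, uniformly in u; D collects the first two
  -- absolute moments of K.
  have hsm : ∀ r : ℝ, 1 ≤ r → ∀ u : ℝ, ‖G u - ∫ s, G (u + r⁻¹ * s) * K s‖ ≤ r⁻¹ * D := by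
    intro r hr u
    have hr0 : 0 < r := by linarith
    have hri : r⁻¹ ≤ 1 := inv_le_one_of_one_le₀ hr
    have e : G u - ∫ s, G (u + r⁻¹ * s) * K s = ∫ s, (G u - G (u + r⁻¹ * s)) * K s := by
      simp_rw [sub_mul]
      rw [integral_sub (K.integrable.const_mul _) (hint r hr u), integral_const_mul, hK1, mul_one]
    rw [e, hD, ← integral_const_mul, ← integral_const_mul]
    refine norm_integral_le_of_norm_le (((hKi1.add hKi2).const_mul C).const_mul r⁻¹)
      (ae_of_all _ fun s => ?_)
    rw [norm_mul, norm_sub_rev]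
    have h1 := hG u (u + r⁻¹ * s)
    rw [add_sub_cancel_left, abs_mul, abs_of_pos (inv_pos.2 hr0)] at h1
    calc ‖G (u + r⁻¹ * s) - G u‖ * ‖K s‖
        ≤ (C * (r⁻¹ * |s| + (r⁻¹ * |s|) ^ 2)) * ‖K s‖ := by gcongr
      _ = r⁻¹ * (C * (|s| * ‖K s‖ + r⁻¹ * (|s| ^ 2 * ‖K s‖))) := by ring
      _ ≤ r⁻¹ * (C * (|s| * ‖K s‖ + 1 * (|s| ^ 2 * ‖K s‖))) := by gcongr
      _ = _ := by rw [Real.norm_eq_abs, pow_one, one_mul]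
  -- For fixed r, the half-line t > 0 is governed by the Laplace transform and vanishes by
  -- Riemann–Lebesgue. The half-line t ≤ 0 recedes into the tail of K.
  have hsplit : ∀ r : ℝ, 1 ≤ r → Tendsto (fun u => ∫ s, G (u + r⁻¹ * s) * K s) atTop (𝓝 0) := by
    intro r hr
    have hr0 : 0 < r := by linarith
    have e : ∀ u, ∫ s, G (u + r⁻¹ * s) * K s =
        r * (∫ t in Ioi (0 : ℝ), G t * K (r * (t - u))) +
          ∫ s, (Iic (0 : ℝ)).indicator G (u + r⁻¹ * s) * K s := by
      intro u
      have e1 : ∫ s, (Ioi (0 : ℝ)).indicator G (u + r⁻¹ * s) * K s =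
          r * (∫ t in Ioi (0 : ℝ), G t * K (r * (t - u))) := by
        have := Measure.integral_comp_mul_left (fun x => (Ioi (0 : ℝ)).indicator
          (fun t => G t * K (r * (t - u))) (u + x)) r⁻¹
        rw [integral_add_left_eq_self (μ := volume) ((Ioi (0 : ℝ)).indicator
          (fun t => G t * K (r * (t - u)))) u, integral_indicator measurableSet_Ioi, inv_inv,
          abs_of_pos hr0] at this
        rw [← Complex.real_smul, ← this]
        congr 1; ext s
        by_cases h : u + r⁻¹ * s ∈ Ioi (0 : ℝ)
        · rw [indicator_of_mem h, indicator_of_mem h, add_sub_cancel_left,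
            mul_inv_cancel_left₀ hr0.ne']
        · rw [indicator_of_notMem h, indicator_of_notMem h, zero_mul]
      rw [← e1, ← integral_add]
      · congr 1; ext s
        rw [← add_mul]
        congr 1
        by_cases h : 0 < u + r⁻¹ * s
        · simp [indicator, h, h.not_ge]
        · simp [indicator, h, not_lt.1 h]
      · refine (hint r hr u).mono (((hGc.measurable.indicator measurableSet_Ioi).comp
          (by fun_prop)).mul K.continuous.measurable).aestronglyMeasurable
          (ae_of_all _ fun s => ?_)
        rw [norm_mul, norm_mul]
        gcongr
        exact norm_indicator_le_norm_self _ _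
      · refine (hint r hr u).mono (((hGc.measurable.indicator measurableSet_Iic).comp
          (by fun_prop)).mul K.continuous.measurable).aestronglyMeasurable
          (ae_of_all _ fun s => ?_)
        rw [norm_mul, norm_mul]
        gcongr
        exact norm_indicator_le_norm_self _ _
    simp_rw [e]
    rw [← add_zero (0 : ℂ)]
    refine Tendsto.add ?_ ?_
    · have hRL := (Real.tendsto_integral_exp_smul_cocompact
        (fun y : ℝ => φ y * H ((2 * Real.pi * r * y : ℝ) * Complex.I))).comp
        ((tendsto_neg_atTop_atBot.comp (tendsto_id.const_mul_atTop hr0)).mono_right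
          atBot_le_cocompact)
      rw [← mul_zero (r : ℂ)]
      refine (hRL.congr fun u => ?_).const_mul _
      exact (integral_mul_fourier_eq hGc hA hH hL hφ hr0 u).symm
    · have := tendsto_integral_filter_of_dominated_convergence (μ := volume) (l := atTop)
        (F := fun (u : ℝ) (s : ℝ) => (Iic (0 : ℝ)).indicator G (u + r⁻¹ * s) * K s)
        (f := fun _ => 0) (fun s => A * ((1 + (0 + r⁻¹ * s) ^ 2) * ‖K s‖)) ?_ ?_
        ((integrable_one_add_sq_mul_schwartz K (inv_pos.2 hr0).le 0).const_mul A) ?_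
      · simpa using this
      · exact Eventually.of_forall fun u => (((hGc.measurable.indicator measurableSet_Iic).comp
          (by fun_prop)).mul K.continuous.measurable).aestronglyMeasurable
      · filter_upwards [eventually_ge_atTop 0] with u hu
        refine ae_of_all _ fun s => ?_
        rw [norm_mul, ← mul_assoc]
        gcongr
        by_cases h : u + r⁻¹ * s ∈ Iic (0 : ℝ)
        · rw [indicator_of_mem h]
          refine (hA _).trans ?_
          have h' : u + r⁻¹ * s ≤ 0 := h
          gcongr A * (1 + ?_)
          -- For u ≥ 0 and u + s/r ≤ 0, the point u + s/r lies between s/r and 0, so the bound is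
          -- independent of u.
          nlinarith
        · rw [indicator_of_notMem h, norm_zero]
          positivity
      · refine ae_of_all _ fun s => ?_
        refine tendsto_const_nhds.congr' ?_
        filter_upwards [eventually_gt_atTop (-(r⁻¹ * s))] with u hu
        rw [indicator_of_notMem, zero_mul]
        simp only [mem_Iic, not_le]
        linarith
  rw [Metric.tendsto_atTop']
  intro ε hε
  obtain ⟨r, hr1, hr⟩ : ∃ r : ℝ, 1 ≤ r ∧ r⁻¹ * D < ε / 2 := by
    refine ⟨max 1 (2 * (D + 1) / ε), le_max_left _ _, ?_⟩
    have h1 : 2 * (D + 1) / ε ≤ max 1 (2 * (D + 1) / ε) := le_max_right _ _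
    have h2 : (0 : ℝ) < max 1 (2 * (D + 1) / ε) := lt_of_lt_of_le one_pos (le_max_left _ _)
    rw [div_le_iff₀ hε] at h1
    rw [inv_mul_lt_iff₀ h2]
    linarith
  obtain ⟨N, hN⟩ := (Metric.tendsto_atTop'.1 (hsplit r hr1)) (ε / 2) (half_pos hε)
  refine ⟨N, fun u hu => ?_⟩
  have h1 := hN u hu
  have h2 := hsm r hr1 u
  rw [dist_zero_right] at h1 ⊢
  have h3 := norm_le_norm_add_norm_sub (∫ s, G (u + r⁻¹ * s) * K s) (G u)
  rw [norm_sub_rev] at h3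
  linarith

end Tauberian
-- Asymptotics of ∑ μ(d)/d and ∑ μ(d).
section Moebius

open MeasureTheory Set Topology
open scoped ArithmeticFunction.Moebius ArithmeticFunction.zeta ArithmeticFunction.vonMangoldt

theorem Icc_one_eq_Ioc_zero (N : ℕ) : Finset.Icc 1 N = Finset.Ioc 0 N := by
  ext; simp; lia

theorem abs_moebius_le_one_real (n : ℕ) : |(μ n : ℝ)| ≤ 1 := by
  have := ArithmeticFunction.abs_moebius_le_one (n := n)
  exact_mod_cast this

theorem sum_moebius_mul_div {N : ℕ} (hN : 1 ≤ N) :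
    ∑ d ∈ Finset.Icc 1 N, (μ d : ℝ) * ((N / d : ℕ) : ℝ) = 1 := by
  have h := ArithmeticFunction.sum_Ioc_mul_zeta_eq_sum (R := ℝ) (μ : ArithmeticFunction ℝ) N
  rw [ArithmeticFunction.coe_moebius_mul_coe_zeta] at h
  rw [Icc_one_eq_Ioc_zero]
  simp only [ArithmeticFunction.intCoe_apply] at h
  rw [← h, Finset.sum_eq_single 1]
  · simp
  · intro b _ hb
    exact ArithmeticFunction.one_apply_ne hb
  · intro h1
    simp at h1
    lia

/-- `∑_{n ≤ x} μ(n) / n`. -/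
noncomputable def moebiusSum (x : ℝ) : ℝ := ∑ d ∈ Finset.Icc 1 ⌊x⌋₊, (μ d : ℝ) / d

/-- Dropping the floors in ∑ μ(d)⌊N/d⌋ = 1 costs at most 1 per term, so N times the sum is at most N
+ 1 in absolute value. -/
theorem abs_moebiusSum_le (x : ℝ) : |moebiusSum x| ≤ 2 := by
  unfold moebiusSum
  generalize ⌊x⌋₊ = N
  rcases Nat.eq_zero_or_pos N with rfl | hN
  · simp
  have hN' : (1 : ℝ) ≤ N := by exact_mod_cast hN
  have h1 : (N : ℝ) * ∑ d ∈ Finset.Icc 1 N, (μ d : ℝ) / d - 1 =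
      ∑ d ∈ Finset.Icc 1 N, (μ d : ℝ) * ((N : ℝ) / d - ((N / d : ℕ) : ℝ)) := by
    rw [← sum_moebius_mul_div hN, Finset.mul_sum, ← Finset.sum_sub_distrib]
    refine Finset.sum_congr rfl fun d _ => ?_
    ring
  have h2 : |(N : ℝ) * ∑ d ∈ Finset.Icc 1 N, (μ d : ℝ) / d - 1| ≤ N := by
    rw [h1]
    refine (Finset.abs_sum_le_sum_abs _ _).trans ?_
    calc _ ≤ ∑ d ∈ Finset.Icc 1 N, (1 : ℝ) := Finset.sum_le_sum fun d _ => ?_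
      _ = N := by simp
    rw [abs_mul]
    refine mul_le_one₀ (abs_moebius_le_one_real d) (abs_nonneg _) ?_
    rw [← Nat.floor_div_eq_div (K := ℝ), abs_le]
    have h3 := Nat.floor_le (show (0 : ℝ) ≤ (N : ℝ) / d by positivity)
    have h4 := Nat.lt_floor_add_one ((N : ℝ) / d)
    constructor <;> linarith
  have h3 : (N : ℝ) * |∑ d ∈ Finset.Icc 1 N, (μ d : ℝ) / d| ≤ N * 2 := by
    rw [← abs_of_nonneg (show (0 : ℝ) ≤ N by positivity), ← abs_mul,
      abs_of_nonneg (show (0 : ℝ) ≤ N by positivity)]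
    have := abs_sub_abs_le_abs_sub ((N : ℝ) * ∑ d ∈ Finset.Icc 1 N, (μ d : ℝ) / d) 1
    rw [abs_one] at this
    linarith
  exact le_of_mul_le_mul_left h3 (by linarith)

theorem sum_inv_Ioc_le {n m : ℕ} (h : n + 1 ≤ m) :
    ∑ d ∈ Finset.Ioc n m, (1 : ℝ) / d ≤ 1 / ((n : ℝ) + 1) + (Real.log m - Real.log (n + 1)) := by
  induction m, h using Nat.le_induction with
  | base => simp
  | succ m hm ih =>
    rw [Finset.sum_Ioc_succ_top (by lia)]
    have hm0 : (0 : ℝ) < m := by exact_mod_cast (by lia : 0 < m)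
    have h1 := Real.one_sub_inv_le_log_of_pos (show (0 : ℝ) < ((m + 1 : ℕ) : ℝ) / m by positivity)
    rw [Real.log_div (by positivity) hm0.ne'] at h1
    have h2 : 1 - (((m + 1 : ℕ) : ℝ) / m)⁻¹ = 1 / ((m + 1 : ℕ) : ℝ) := by
      push_cast; field_simp; ring
    linarith

theorem sum_inv_Ioc_floor_exp_le {s t : ℝ} (hst : s ≤ t) :
    ∑ d ∈ Finset.Ioc ⌊Real.exp s⌋₊ ⌊Real.exp t⌋₊, (1 : ℝ) / d ≤
      (t - s) + 1 / ((⌊Real.exp s⌋₊ : ℝ) + 1) := by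
  rcases Nat.lt_or_ge ⌊Real.exp s⌋₊ ⌊Real.exp t⌋₊ with h | h
  · refine (sum_inv_Ioc_le h).trans ?_
    have h1 : Real.log ⌊Real.exp t⌋₊ ≤ t := by
      rw [Real.log_le_iff_le_exp (by exact_mod_cast (by lia : 0 < ⌊Real.exp t⌋₊))]
      exact Nat.floor_le (Real.exp_nonneg _)
    have h2 : s ≤ Real.log (⌊Real.exp s⌋₊ + 1) := by
      rw [Real.le_log_iff_exp_le (by positivity)]
      exact (Nat.lt_floor_add_one _).le
    linarith
  · rw [Finset.Ioc_eq_empty_of_le h, Finset.sum_empty]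
    have : (0 : ℝ) ≤ 1 / ((⌊Real.exp s⌋₊ : ℝ) + 1) := by positivity
    linarith

/-- `∑_{d ≤ e ^ t} μ(d) / d * log (e ^ t / d)`. -/
noncomputable def moebiusLogSum (t : ℝ) : ℝ :=
  ∑ d ∈ Finset.Icc 1 ⌊Real.exp t⌋₊, (μ d : ℝ) / d * (t - Real.log d)

/-- `moebiusSum` is the slope of `moebiusLogSum`: each old term grows by (t - s)μ(d)/d, and each new
term, with e^s < d ≤ e^t, is at most (t - s)/d. This yields slow variation and, later, the limit of
the slope. -/
theorem abs_moebiusLogSum_sub_le {s t : ℝ} (hst : s ≤ t) :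
    |moebiusLogSum t - moebiusLogSum s - (t - s) * moebiusSum (Real.exp s)| ≤
      (t - s) * ((t - s) + 1 / ((⌊Real.exp s⌋₊ : ℝ) + 1)) := by
  have hfl : ⌊Real.exp s⌋₊ ≤ ⌊Real.exp t⌋₊ := Nat.floor_mono (Real.exp_le_exp.2 hst)
  have e : moebiusLogSum t - moebiusLogSum s - (t - s) * moebiusSum (Real.exp s) =
      ∑ d ∈ Finset.Ioc ⌊Real.exp s⌋₊ ⌊Real.exp t⌋₊, (μ d : ℝ) / d * (t - Real.log d) := by
    unfold moebiusLogSum moebiusSum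
    simp_rw [Icc_one_eq_Ioc_zero]
    rw [← Finset.sum_Ioc_consecutive _ (Nat.zero_le _) hfl, Finset.mul_sum, sub_sub,
      ← Finset.sum_add_distrib, sub_eq_iff_eq_add, add_comm]
    congr 1
    refine Finset.sum_congr rfl fun d _ => ?_
    ring
  rw [e]
  refine (Finset.abs_sum_le_sum_abs _ _).trans ?_
  refine le_trans ?_ (mul_le_mul_of_nonneg_left (sum_inv_Ioc_floor_exp_le hst)
    (sub_nonneg.2 hst))
  rw [Finset.mul_sum]
  refine Finset.sum_le_sum fun d hd => ?_
  rw [Finset.mem_Ioc] at hd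
  have hd0 : (0 : ℝ) < d := by exact_mod_cast (by lia : 0 < d)
  have h1 : Real.log d ≤ t := by
    rw [Real.log_le_iff_le_exp hd0]
    exact (Nat.le_floor_iff (Real.exp_nonneg _)).1 hd.2
  have h2 : s ≤ Real.log d := by
    rw [Real.le_log_iff_exp_le hd0]
    exact ((Nat.floor_lt (Real.exp_nonneg _)).1 hd.1).le
  rw [abs_mul, abs_div, abs_of_pos hd0, abs_of_nonneg (sub_nonneg.2 h1), mul_comm (t - s)]
  have := abs_moebius_le_one_real d
  gcongr

theorem abs_moebiusLogSum_sub_le' (s t : ℝ) :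
    |moebiusLogSum t - moebiusLogSum s| ≤ 3 * (|t - s| + |t - s| ^ 2) := by
  wlog hst : s ≤ t generalizing s t
  · rw [abs_sub_comm, abs_sub_comm t s]
    exact this t s (le_of_not_ge hst)
  have h1 := abs_moebiusLogSum_sub_le hst
  have h2 := abs_moebiusSum_le (Real.exp s)
  have h3 : 1 / ((⌊Real.exp s⌋₊ : ℝ) + 1) ≤ 1 :=
    div_le_one_of_le₀ (by simp) (by positivity)
  have h0 : 0 ≤ t - s := sub_nonneg.2 hst
  rw [abs_of_nonneg h0]
  have h4 := abs_sub_abs_le_abs_sub (moebiusLogSum t - moebiusLogSum s)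
    ((t - s) * moebiusSum (Real.exp s))
  rw [abs_mul, abs_of_nonneg h0] at h4
  nlinarith [mul_le_mul_of_nonneg_left h2 h0, mul_le_mul_of_nonneg_left h3 h0]

/-- The entire function `z * ζ(1 + z)`, with the value `1` at `z = 0`. -/
noncomputable def shiftedZeta (z : ℂ) : ℂ := DirichletCharacter.LFunctionTrivChar₁ 1 (1 + z)

theorem shiftedZeta_zero : shiftedZeta 0 = 1 := by
  simp [shiftedZeta]

theorem shiftedZeta_of_ne_zero {z : ℂ} (hz : z ≠ 0) :
    shiftedZeta z = z * riemannZeta (1 + z) := by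
  simp [shiftedZeta, DirichletCharacter.LFunctionTrivChar₁, Function.update_of_ne, hz,
    DirichletCharacter.LFunctionTrivChar]

theorem shiftedZeta_ne_zero {z : ℂ} (hz : 0 ≤ z.re) : shiftedZeta z ≠ 0 := by
  rcases eq_or_ne z 0 with rfl | h
  · simp [shiftedZeta_zero]
  · rw [shiftedZeta_of_ne_zero h]
    exact mul_ne_zero h (riemannZeta_ne_zero_of_one_le_re (by simpa using hz))

theorem differentiable_shiftedZeta : Differentiable ℂ shiftedZeta :=
  (DirichletCharacter.differentiable_LFunctionTrivChar₁ 1).comp (by fun_prop)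

/-- Away from 0 this function is 1/(z²ζ(1+z)) - 1/z; `dslope` fills the removable singularity.
Non-vanishing of ζ on Re s ≥ 1 is what carries it to the boundary. -/
theorem continuousOn_dslope_inv_shiftedZeta :
    ContinuousOn (dslope (fun z => (shiftedZeta z)⁻¹) 0) {z | 0 ≤ z.re} := by
  intro z hz
  have hd : DifferentiableAt ℂ (fun z => (shiftedZeta z)⁻¹) z :=
    (differentiable_shiftedZeta z).inv (shiftedZeta_ne_zero hz)
  refine ContinuousAt.continuousWithinAt ?_
  rcases eq_or_ne z 0 with rfl | h
  · exact continuousAt_dslope_same.2 hd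
  · exact (continuousAt_dslope_of_ne h).2 hd.continuousAt

theorem integral_mul_exp_neg_Ioi {z : ℂ} (hz : 0 < z.re) :
    ∫ t in Ioi (0 : ℝ), (t : ℂ) * Complex.exp (-(z * t)) = 1 / z ^ 2 := by
  have hz0 : z ≠ 0 := by rintro rfl; simp at hz
  have hd : ∀ t ∈ Ici (0 : ℝ), HasDerivAt
      (fun t : ℝ => -((t : ℂ) / z + 1 / z ^ 2) * Complex.exp (-(z * t)))
      ((t : ℂ) * Complex.exp (-(z * t))) t := by
    intro t _
    have h0 : HasDerivAt (fun t : ℝ => (t : ℂ)) 1 t := Complex.ofRealCLM.hasDerivAt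
    have h1 := ((h0.div_const z).add_const (1 / z ^ 2)).neg
    have h2 := ((h0.const_mul z).neg).cexp
    convert! h1.mul h2 using 1
    simp only [Pi.neg_apply]
    field_simp
    ring
  have hi : IntegrableOn (fun t : ℝ => (t : ℂ) * Complex.exp (-(z * t))) (Ioi 0) := by
    refine integrableOn_mul_exp_of_le_sq (G := fun t : ℝ => (t : ℂ)) (by fun_prop)
      (A := 1) (fun t => ?_) hz
    rw [Complex.norm_real, Real.norm_eq_abs, abs_le]
    constructor <;> nlinarith [sq_nonneg (t + 1), sq_nonneg (t - 1)]
  have ht : Tendsto (fun t : ℝ => -((t : ℂ) / z + 1 / z ^ 2) * Complex.exp (-(z * t))) atTop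
      (𝓝 0) := by
    rw [tendsto_zero_iff_norm_tendsto_zero]
    have h1 := (tendsto_rpow_mul_exp_neg_mul_atTop_nhds_zero 1 z.re hz).mul_const ‖z‖⁻¹
    have h2 := (tendsto_rpow_mul_exp_neg_mul_atTop_nhds_zero 0 z.re hz).mul_const ‖z ^ 2‖⁻¹
    have h3 := h1.add h2
    rw [zero_mul, zero_mul, add_zero] at h3
    refine tendsto_of_tendsto_of_tendsto_of_le_of_le' tendsto_const_nhds h3
      (Eventually.of_forall fun t => norm_nonneg _) ?_
    filter_upwards [eventually_ge_atTop 0] with t ht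
    rw [norm_mul, norm_neg, Complex.norm_exp, Real.rpow_one, Real.rpow_zero]
    have h4 : (-(z * t)).re = -z.re * t := by simp
    have h5 := norm_add_le ((t : ℂ) / z) (1 / z ^ 2)
    rw [norm_div, norm_div, norm_one, Complex.norm_real, Real.norm_of_nonneg ht] at h5
    rw [h4]
    calc _ ≤ (t / ‖z‖ + 1 / ‖z ^ 2‖) * Real.exp (-z.re * t) := by gcongr
      _ = _ := by ring
  rw [integral_Ioi_of_hasDerivAt_of_tendsto' hd hi ht]
  simp

theorem continuous_moebiusLogSum : Continuous moebiusLogSum := by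
  rw [continuous_iff_continuousAt]
  intro s
  rw [ContinuousAt, tendsto_iff_norm_sub_tendsto_zero]
  refine squeeze_zero (fun _ => norm_nonneg _) (fun t => abs_moebiusLogSum_sub_le' s t) ?_
  have : Continuous fun t : ℝ => 3 * (|t - s| + |t - s| ^ 2) := by fun_prop
  simpa using this.tendsto s

theorem abs_moebiusLogSum_le (t : ℝ) : |moebiusLogSum t| ≤ 6 * (1 + t ^ 2) := by
  have h1 := abs_moebiusLogSum_sub_le' 0 t
  have h0 : moebiusLogSum 0 = 0 := by simp [moebiusLogSum]
  rw [h0, sub_zero, sub_zero, sq_abs] at h1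
  have h3 : |t| ≤ 1 + t ^ 2 :=
    abs_le.2 ⟨by nlinarith [sq_nonneg (t + 1)], by nlinarith [sq_nonneg (t - 1)]⟩
  linarith

theorem integral_max_sub_mul_exp {a : ℝ} (ha : 0 ≤ a) {z : ℂ} (hz : 0 < z.re) :
    ∫ t in Ioi (0 : ℝ), ((max (t - a) 0 : ℝ) : ℂ) * Complex.exp (-(z * t)) =
      Complex.exp (-(z * a)) / z ^ 2 := by
  have h1 : ∫ t in Ioi (0 : ℝ), (t : ℂ) ^ ((2 : ℂ) - 1) * Complex.exp (-(z * t)) = 1 / z ^ 2 := by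
    simp_rw [show (2 : ℂ) - 1 = 1 by norm_num, Complex.cpow_one]
    exact integral_mul_exp_neg_Ioi hz
  have h2 : ∀ t : ℝ, (Ioi (0 : ℝ)).indicator (fun t : ℝ => ((max (t - a) 0 : ℝ) : ℂ) *
      Complex.exp (-(z * t))) t = Complex.exp (-(z * a)) * (Ioi (0 : ℝ)).indicator
        (fun t : ℝ => (t : ℂ) ^ ((2 : ℂ) - 1) * Complex.exp (-(z * t))) (t - a) := by
    intro t
    by_cases h : 0 < t - a
    · rw [indicator_of_mem (show t ∈ Ioi (0 : ℝ) by simp; linarith),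
        indicator_of_mem (show t - a ∈ Ioi (0 : ℝ) from h), max_eq_left h.le,
        show (2 : ℂ) - 1 = 1 by norm_num, Complex.cpow_one, mul_left_comm, ← Complex.exp_add]
      congr 2
      push_cast; ring
    · rw [indicator_of_notMem (show t - a ∉ Ioi (0 : ℝ) from h), mul_zero]
      by_cases h' : t ∈ Ioi (0 : ℝ)
      · rw [indicator_of_mem h', max_eq_right (not_lt.1 h)]
        simp
      · rw [indicator_of_notMem h']
  rw [← integral_indicator measurableSet_Ioi]
  simp_rw [h2]
  rw [integral_const_mul, integral_sub_right_eq_self ((Ioi (0 : ℝ)).indicator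
    (fun t : ℝ => (t : ℂ) ^ ((2 : ℂ) - 1) * Complex.exp (-(z * t)))) a,
    integral_indicator measurableSet_Ioi, h1]
  ring

/-- The positive part absorbs the cutoff d ≤ e^t, so the index set no longer depends on t and the
sum can be integrated termwise. -/
theorem hasSum_moebiusLogSum (t : ℝ) :
    HasSum (fun d : ℕ => (μ d : ℝ) / d * max (t - Real.log d) 0) (moebiusLogSum t) := by
  have : moebiusLogSum t = ∑ d ∈ Finset.Icc 1 ⌊Real.exp t⌋₊,
      (μ d : ℝ) / d * max (t - Real.log d) 0 := by
    refine Finset.sum_congr rfl fun d hd => ?_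
    rw [Finset.mem_Icc] at hd
    rw [max_eq_left]
    rw [sub_nonneg, Real.log_le_iff_le_exp (by exact_mod_cast (by lia : 0 < d))]
    exact (Nat.le_floor_iff (Real.exp_nonneg _)).1 hd.2
  rw [this]
  refine hasSum_sum_of_ne_finset_zero fun d hd => ?_
  rcases Nat.eq_zero_or_pos d with rfl | h0
  · simp
  · rw [max_eq_right, mul_zero]
    rw [sub_nonpos, Real.le_log_iff_exp_le (by exact_mod_cast h0)]
    refine ((Nat.floor_lt (Real.exp_nonneg _)).1 ?_).le
    rw [Finset.mem_Icc] at hd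
    lia

/-- The ramp starting at log d has transform d^(-z)/z², so the terms assemble into z⁻² ∑ μ(d)
d^(-1-z), which converges absolutely for Re z > 0. -/
theorem integral_moebiusLogSum_mul_exp {z : ℂ} (hz : 0 < z.re) :
    ∫ t in Ioi (0 : ℝ), (moebiusLogSum t : ℂ) * Complex.exp (-(z * t)) =
      1 / (z ^ 2 * riemannZeta (1 + z)) := by
  set F : ℕ → ℝ → ℂ := fun d t =>
    (μ d : ℂ) / d * (((max (t - Real.log d) 0 : ℝ) : ℂ) * Complex.exp (-(z * t))) with hF
  have hlog : ∀ d : ℕ, 0 ≤ Real.log d := fun d => Real.log_natCast_nonneg d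
  have hmax : ∀ d : ℕ, ∀ w : ℂ, 0 < w.re → IntegrableOn (fun t : ℝ =>
      ((max (t - Real.log d) 0 : ℝ) : ℂ) * Complex.exp (-(w * t))) (Ioi 0) := by
    intro d w hw
    refine integrableOn_mul_exp_of_le_sq
      (G := fun t : ℝ => ((max (t - Real.log d) 0 : ℝ) : ℂ)) (by fun_prop)
      (A := 1 + Real.log d) (fun t => ?_) hw
    rw [Complex.norm_real, Real.norm_of_nonneg (le_max_right _ _)]
    have := hlog d
    refine max_le ?_ (by positivity)
    nlinarith [sq_nonneg (t - 1), mul_nonneg this (sq_nonneg t)]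
  have hFint : ∀ d, Integrable (F d) (volume.restrict (Ioi 0)) := fun d =>
    (hmax d z hz).const_mul _
  have hexp : ∀ d : ℕ, 1 ≤ d → ∀ w : ℂ, Complex.exp (-(w * Real.log d)) = (d : ℂ) ^ (-w) := by
    intro d hd w
    rw [Complex.cpow_def_of_ne_zero (by exact_mod_cast (by lia : d ≠ 0)), ← Complex.natCast_log]
    congr 1; ring
  have hterm : ∀ d, ∫ t in Ioi (0 : ℝ), F d t = 1 / z ^ 2 * LSeries.term (fun n => (μ n : ℂ)) (1 + z) d := by
    intro d
    simp only [hF]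
    rw [integral_const_mul, integral_max_sub_mul_exp (hlog d) hz]
    rcases Nat.eq_zero_or_pos d with rfl | h0
    · simp
    · have hd : (d : ℂ) ≠ 0 := by exact_mod_cast h0.ne'
      rw [LSeries.term_of_ne_zero h0.ne', hexp d h0, Complex.cpow_add _ _ hd, Complex.cpow_one,
        Complex.cpow_neg]
      field_simp
  have hsummable : LSeriesSummable (fun n => (μ n : ℂ)) (1 + z) :=
    ArithmeticFunction.LSeriesSummable_moebius_iff.2 (by simpa using hz)
  -- The ramp is nonnegative, so the integral of the norm is the same formula evaluated at the real
  -- point Re z.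
  have hnorm : ∀ d, ∫ t in Ioi (0 : ℝ), ‖F d t‖ =
      1 / z.re ^ 2 * ‖LSeries.term (fun n => (μ n : ℂ)) (1 + z) d‖ := by
    intro d
    have hre : 0 < ((z.re : ℝ) : ℂ).re := by simpa using hz
    have e1 : ∫ t in Ioi (0 : ℝ), max (t - Real.log d) 0 * Real.exp (-(z.re * t)) =
        Real.exp (-(z.re * Real.log d)) / z.re ^ 2 := by
      have := integral_max_sub_mul_exp (hlog d) hre
      rw [← Complex.ofReal_inj, ← integral_complex_ofReal]
      push_cast at this ⊢
      exact this
    have e2 : ∀ t, ‖F d t‖ =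
        ‖(μ d : ℂ) / d‖ * (max (t - Real.log d) 0 * Real.exp (-(z.re * t))) := by
      intro t
      simp only [hF]
      rw [norm_mul, norm_mul, Complex.norm_real, Real.norm_of_nonneg (le_max_right _ _),
        Complex.norm_exp]
      simp
    simp_rw [e2]
    rw [integral_const_mul, e1]
    rcases Nat.eq_zero_or_pos d with rfl | h0
    · simp
    · have hd : (d : ℂ) ≠ 0 := by exact_mod_cast h0.ne'
      rw [LSeries.term_of_ne_zero h0.ne', norm_div, norm_div, Complex.cpow_add _ _ hd,
        Complex.cpow_one, norm_mul]
      have : ‖(d : ℂ) ^ z‖ = Real.exp (z.re * Real.log d) := by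
        rw [Complex.norm_natCast_cpow_of_pos h0, Real.rpow_def_of_pos (by exact_mod_cast h0),
          mul_comm]
      rw [this, Real.exp_neg]
      have := Real.exp_pos (z.re * Real.log d)
      field_simp
  have hs := hasSum_integral_of_summable_integral_norm hFint (by
    simp_rw [hnorm]
    exact (hsummable.norm).mul_left _)
  have htsum : ∀ t, ∑' d, F d t = (moebiusLogSum t : ℂ) * Complex.exp (-(z * t)) := by
    intro t
    have h := ((Complex.hasSum_ofReal.2 (hasSum_moebiusLogSum t)).mul_right
      (Complex.exp (-(z * t)))).tsum_eq
    rw [← h]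
    refine tsum_congr fun d => ?_
    simp only [hF]
    push_cast
    ring
  simp_rw [htsum, hterm] at hs
  have h2 := hs.unique ((hsummable.hasSum).mul_left (1 / z ^ 2))
  rw [h2]
  have h3 := ArithmeticFunction.LSeries_zeta_mul_Lseries_moebius (s := 1 + z) (by simpa using hz)
  rw [ArithmeticFunction.LSeries_zeta_eq_riemannZeta (by simpa using hz)] at h3
  change 1 / z ^ 2 * LSeries (fun n => (μ n : ℂ)) (1 + z) = _
  rw [one_div, one_div, mul_inv, eq_inv_of_mul_eq_one_right h3]

theorem tendsto_moebiusLogSum : Tendsto moebiusLogSum atTop (𝓝 1) := by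
  have h := tendsto_zero_of_laplace (G := fun t => ((moebiusLogSum t : ℝ) : ℂ) - 1) (C := 3)
    (H := dslope (fun z => (shiftedZeta z)⁻¹) 0) ?_ continuousOn_dslope_inv_shiftedZeta ?_
  · have h1 := h.add_const 1
    simp only [sub_add_cancel, zero_add] at h1
    have h2 := (Complex.continuous_re.tendsto _).comp h1
    rw [Complex.one_re] at h2
    exact h2
  · intro s t
    rw [sub_sub_sub_cancel_right, ← Complex.ofReal_sub, Complex.norm_real]
    exact abs_moebiusLogSum_sub_le' s t
  · intro z hz
    have hz0 : z ≠ 0 := by rintro rfl; simp at hz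
    simp_rw [sub_mul, one_mul]
    have hi1 := integrableOn_mul_exp_of_le_sq (G := fun t => ((moebiusLogSum t : ℝ) : ℂ))
      (A := 6) (Complex.continuous_ofReal.comp continuous_moebiusLogSum)
      (fun t => by rw [Complex.norm_real]; exact abs_moebiusLogSum_le t) hz
    have hi2 := integrableOn_mul_exp_of_le_sq (G := fun _ => (1 : ℂ)) (A := 1) (by fun_prop)
      (fun t => by rw [norm_one]; nlinarith [sq_nonneg t]) hz
    simp only [one_mul] at hi2
    rw [integral_sub hi1 hi2, integral_moebiusLogSum_mul_exp hz]
    have h2 : ∫ t in Ioi (0 : ℝ), Complex.exp (-(z * t)) = 1 / z := by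
      have := integral_exp_mul_complex_Ioi (a := -z) (by simpa using hz) 0
      simp only [neg_mul] at this
      rw [this]
      simp
    rw [h2, dslope_of_ne _ hz0, slope_def_field, shiftedZeta_zero, shiftedZeta_of_ne_zero hz0]
    have h4 : riemannZeta (1 + z) ≠ 0 := riemannZeta_ne_zero_of_one_le_re (by simpa using hz.le)
    field_simp
    simp only [sub_zero]
    ring

/-- The increments of the convergent function `moebiusLogSum` over a fixed window h tend to 0, and
its slope differs from the difference quotient by little more than h. -/
theorem tendsto_moebiusSum : Tendsto moebiusSum atTop (𝓝 0) := by
  have hexp : Tendsto (fun s => moebiusSum (Real.exp s)) atTop (𝓝 0) := by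
    rw [Metric.tendsto_atTop']
    intro ε hε
    -- The increment and the two slope errors contribute at most h each, so the bound is 3h < ε.
    set h : ℝ := ε / 4 with hh
    have h0 : 0 < h := by positivity
    have t1 : Tendsto (fun s => |moebiusLogSum (s + h) - moebiusLogSum s|) atTop (𝓝 0) := by
      have := ((tendsto_moebiusLogSum.comp (tendsto_atTop_add_const_right _ h tendsto_id)).sub
        tendsto_moebiusLogSum).abs
      simpa using this
    have t2 : Tendsto (fun s => 1 / ((⌊Real.exp s⌋₊ : ℝ) + 1)) atTop (𝓝 0) :=
      tendsto_one_div_add_atTop_nhds_zero_nat.comp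
        (tendsto_nat_floor_atTop.comp Real.tendsto_exp_atTop)
    obtain ⟨N, hN⟩ := eventually_atTop.1 ((t1.eventually_lt_const (show 0 < h * h by positivity)).and
      (t2.eventually_lt_const h0))
    refine ⟨N, fun s hs => ?_⟩
    obtain ⟨h1, h2⟩ := hN s hs.le
    have h3 := abs_moebiusLogSum_sub_le (show s ≤ s + h by linarith)
    rw [add_sub_cancel_left] at h3
    have h4 := abs_sub_abs_le_abs_sub (h * moebiusSum (Real.exp s))
      (moebiusLogSum (s + h) - moebiusLogSum s)
    rw [abs_sub_comm (h * _), abs_mul, abs_of_pos h0] at h4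
    rw [dist_zero_right, Real.norm_eq_abs]
    have h5 : h * |moebiusSum (Real.exp s)| < h * (3 * h) := by nlinarith
    have := lt_of_mul_lt_mul_left h5 h0.le
    linarith
  refine (hexp.comp Real.tendsto_log_atTop).congr' ?_
  filter_upwards [eventually_gt_atTop 0] with x hx
  simp [Real.exp_log hx]

theorem tendsto_mertens_div :
    Tendsto (fun N : ℕ => (∑ d ∈ Finset.Icc 1 N, (μ d : ℝ)) / N) atTop (𝓝 0) := by
  have hg : Tendsto (fun N : ℕ => moebiusSum N) atTop (𝓝 0) :=
    tendsto_moebiusSum.comp tendsto_natCast_atTop_atTop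
  have hces := hg.sub hg.cesaro
  rw [sub_zero] at hces
  refine hces.congr' ?_
  filter_upwards [eventually_gt_atTop 0] with N hN
  -- Partial summation: after division by N this is a null sequence minus its Cesàro mean.
  have key : ∑ d ∈ Finset.Icc 1 N, (μ d : ℝ) =
      N * moebiusSum N - ∑ k ∈ Finset.range N, moebiusSum k := by
    clear hN
    induction N with
    | zero => simp [moebiusSum]
    | succ n ih =>
      have h1 : moebiusSum ((n + 1 : ℕ) : ℝ) =
          moebiusSum n + (μ (n + 1) : ℝ) / ((n + 1 : ℕ) : ℝ) := by
        simp only [moebiusSum, Nat.floor_natCast]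
        rw [Finset.sum_Icc_succ_top (by lia)]
      rw [Finset.sum_Icc_succ_top (by lia), ih, Finset.sum_range_succ, h1]
      push_cast
      field_simp
      ring
  rw [key]
  have : (N : ℝ) ≠ 0 := by exact_mod_cast hN.ne'
  field_simp

end Moebius
-- Chebyshev's method: main term and remainder.
section Method

open Topology
open scoped ArithmeticFunction.Moebius ArithmeticFunction.zeta ArithmeticFunction.vonMangoldt

theorem logSum_eq_sum_vonMangoldt (y : ℝ) :
    logSum y = ∑ l ∈ Finset.Icc 1 ⌊y⌋₊, Λ l * ((⌊y⌋₊ / l : ℕ) : ℝ) := by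
  have h := ArithmeticFunction.sum_Ioc_mul_zeta_eq_sum (R := ℝ) Λ ⌊y⌋₊
  rw [ArithmeticFunction.vonMangoldt_mul_zeta] at h
  rw [logSum, Icc_one_eq_Ioc_zero, ← h]
  exact Finset.sum_congr rfl fun n _ => (ArithmeticFunction.log_apply).symm

theorem weightSum_eq (a : ℕ → ℝ) (t : ℝ) :
    weightSum a t = ∑ d ∈ Finset.Icc 1 ⌊t⌋₊, a d * ((⌊t⌋₊ / d : ℕ) : ℝ) := by
  simp only [weightSum, Nat.floor_div_natCast]

/-- The added terms have quotient zero. The range of l no longer depends on d, which allows the sums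
over d and l to be exchanged. -/
theorem sum_Icc_div_extend (f : ℕ → ℝ) (N d : ℕ) :
    ∑ l ∈ Finset.Icc 1 (N / d), f l * ((N / d / l : ℕ) : ℝ) =
      ∑ l ∈ Finset.Icc 1 N, f l * ((N / d / l : ℕ) : ℝ) := by
  refine Finset.sum_subset (Finset.Icc_subset_Icc_right (Nat.div_le_self _ _)) fun l hl hl' => ?_
  rw [Finset.mem_Icc] at hl hl'
  rw [Nat.div_eq_of_lt (by lia)]
  simp

theorem approxPsi_eq_sum_vonMangoldt (a : ℕ → ℝ) (x : ℝ) :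
    approxPsi a x = ∑ l ∈ Finset.Icc 1 ⌊x⌋₊, Λ l * weightSum a (x / l) := by
  simp only [approxPsi, logSum_eq_sum_vonMangoldt, weightSum_eq, Nat.floor_div_natCast,
    sum_Icc_div_extend, Finset.mul_sum]
  rw [Finset.sum_comm]
  refine Finset.sum_congr rfl fun l _ => Finset.sum_congr rfl fun d _ => ?_
  rw [Nat.div_div_eq_div_mul, Nat.div_div_eq_div_mul, mul_comm d l]
  ring

theorem abs_psi_sub_le (a : ℕ → ℝ) (x : ℝ) :
    |Chebyshev.psi x - x| ≤ |approxPsi a x - x| + remainder a x := by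
  have h : |approxPsi a x - Chebyshev.psi x| ≤ remainder a x := by
    rw [approxPsi_eq_sum_vonMangoldt, Chebyshev.psi, ← Icc_one_eq_Ioc_zero,
      ← Finset.sum_sub_distrib, remainder]
    refine (Finset.abs_sum_le_sum_abs _ _).trans (Finset.sum_le_sum fun l _ => ?_)
    rw [show Λ l * weightSum a (x / l) - Λ l = Λ l * (weightSum a (x / l) - 1) by ring, abs_mul,
      abs_of_nonneg ArithmeticFunction.vonMangoldt_nonneg]
  have h2 := abs_sub_le (Chebyshev.psi x) (approxPsi a x) x
  rw [abs_sub_comm (Chebyshev.psi x) (approxPsi a x)] at h2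
  linarith

theorem remainder_nonneg (a : ℕ → ℝ) (x : ℝ) : 0 ≤ remainder a x :=
  Finset.sum_nonneg fun _ _ =>
    mul_nonneg ArithmeticFunction.vonMangoldt_nonneg (abs_nonneg _)

/-! ### Stirling's formula with a logarithmic error -/

/-- As y log y - y is a primitive of log, these are the endpoint bounds for the integral of an
increasing function. -/
theorem mul_log_sub_bounds {a b : ℝ} (ha : 0 < a) (hab : a ≤ b) :
    (b - a) * Real.log a ≤ (b * Real.log b - b) - (a * Real.log a - a) ∧
      (b * Real.log b - b) - (a * Real.log a - a) ≤ (b - a) * Real.log b := by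
  have hb : 0 < b := ha.trans_le hab
  have h1 := Real.log_le_sub_one_of_pos (show 0 < b / a by positivity)
  have h2 := Real.one_sub_inv_le_log_of_pos (show 0 < b / a by positivity)
  rw [Real.log_div hb.ne' ha.ne'] at h1 h2
  have h3 : a * (Real.log b - Real.log a) ≤ b - a := by
    calc _ ≤ a * (b / a - 1) := by gcongr
      _ = b - a := by field_simp
  have h4 : b - a ≤ b * (Real.log b - Real.log a) := by
    calc b - a = b * (1 - (b / a)⁻¹) := by field_simp
      _ ≤ _ := by gcongr
  constructor <;> nlinarith

theorem sum_log_bounds {n : ℕ} (hn : 1 ≤ n) :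
    1 ≤ ∑ k ∈ Finset.Icc 1 n, Real.log k - (n * Real.log n - n) ∧
      ∑ k ∈ Finset.Icc 1 n, Real.log k - (n * Real.log n - n) ≤ 1 + Real.log n := by
  induction n, hn using Nat.le_induction with
  | base => simp
  | succ n hn ih =>
    have h0 : (0 : ℝ) < n := by exact_mod_cast hn
    have h := mul_log_sub_bounds h0 (show (n : ℝ) ≤ ((n + 1 : ℕ) : ℝ) by push_cast; linarith)
    rw [Finset.sum_Icc_succ_top (by lia)]
    have e : ((n + 1 : ℕ) : ℝ) - n = 1 := by push_cast; ring
    rw [e] at h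
    constructor <;> linarith [h.1, h.2, ih.1, ih.2]

theorem abs_logSum_sub_le {y : ℝ} (hy : 1 ≤ y) :
    |logSum y - (y * Real.log y - y)| ≤ 1 + Real.log y := by
  have hn : 1 ≤ ⌊y⌋₊ := (Nat.one_le_floor_iff y).2 hy
  have h0 : (1 : ℝ) ≤ ⌊y⌋₊ := by exact_mod_cast hn
  have h1 : (⌊y⌋₊ : ℝ) ≤ y := Nat.floor_le (by linarith)
  have h2 := Nat.lt_floor_add_one y
  have h3 := mul_log_sub_bounds (by linarith) h1
  have h4 := sum_log_bounds hn
  have h5 : 0 ≤ Real.log ⌊y⌋₊ := Real.log_nonneg h0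
  have h6 : Real.log ⌊y⌋₊ ≤ Real.log y := Real.log_le_log (by linarith) h1
  have h7 : (y - ⌊y⌋₊) * Real.log y ≤ 1 * Real.log y := by
    gcongr
    · linarith
    · linarith
  have h8 : 0 ≤ (y - ⌊y⌋₊) * Real.log ⌊y⌋₊ := mul_nonneg (by linarith) h5
  unfold logSum
  rw [abs_le]
  constructor <;> linarith [h3.1, h3.2, h4.1, h4.2]

/-! ### The truncated Möbius function -/

theorem truncatedMoebius_of_lt {T n : ℕ} (h : n < T) : truncatedMoebius T n = μ n := by
  simp [truncatedMoebius, h]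

theorem truncatedMoebius_of_gt {T n : ℕ} (h : T < n) : truncatedMoebius T n = 0 := by
  simp [truncatedMoebius, h.not_gt, h.ne']

theorem truncatedMoebius_self (T : ℕ) :
    truncatedMoebius T T = -(T : ℝ) * ∑ j ∈ Finset.Ico 1 T, (μ j : ℝ) / j := by
  simp [truncatedMoebius]

theorem sum_truncatedMoebius_mul {T : ℕ} (hT : 0 < T) (f : ℕ → ℝ) :
    ∑ d ∈ Finset.Icc 1 T, truncatedMoebius T d * f d =
      ∑ d ∈ Finset.Ico 1 T, (μ d : ℝ) * f d -
        T * (∑ j ∈ Finset.Ico 1 T, (μ j : ℝ) / j) * f T := by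
  rw [← Finset.Ico_insert_right (by lia), Finset.sum_insert (by simp), truncatedMoebius_self]
  have h : ∑ d ∈ Finset.Ico 1 T, truncatedMoebius T d * f d =
      ∑ d ∈ Finset.Ico 1 T, (μ d : ℝ) * f d :=
    Finset.sum_congr rfl fun d hd => by rw [truncatedMoebius_of_lt (Finset.mem_Ico.1 hd).2]
  rw [h]
  ring

theorem sum_Icc_truncatedMoebius_mul {T N : ℕ} (h : T ≤ N) (f : ℕ → ℝ) :
    ∑ d ∈ Finset.Icc 1 N, truncatedMoebius T d * f d =
      ∑ d ∈ Finset.Icc 1 T, truncatedMoebius T d * f d := by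
  refine (Finset.sum_subset (Finset.Icc_subset_Icc_right h) fun d hd hd' => ?_).symm
  rw [Finset.mem_Icc] at hd hd'
  rw [truncatedMoebius_of_gt (by lia), zero_mul]

theorem sum_truncatedMoebius_div {T : ℕ} (hT : 0 < T) :
    ∑ d ∈ Finset.Icc 1 T, truncatedMoebius T d / (d : ℝ) = 0 := by
  have hT' : (T : ℝ) ≠ 0 := by exact_mod_cast hT.ne'
  simp_rw [div_eq_mul_inv]
  rw [sum_truncatedMoebius_mul hT]
  simp_rw [← div_eq_mul_inv]
  field_simp
  ring

/-- The coefficient at T supplies log T · ∑_{j<T} μ(j)/j, which turns each -log d into log(T/d); the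
term d = T on the right is zero. -/
theorem neg_sum_truncatedMoebius_mul_log {T : ℕ} (hT : 0 < T) :
    -(∑ d ∈ Finset.Icc 1 T, truncatedMoebius T d * Real.log (d : ℝ) / (d : ℝ)) =
      moebiusLogSum (Real.log T) := by
  have hT' : (0 : ℝ) < T := by exact_mod_cast hT
  simp_rw [mul_div_assoc]
  rw [sum_truncatedMoebius_mul hT, moebiusLogSum, Real.exp_log hT', Nat.floor_natCast,
    ← Finset.Ico_insert_right (show 1 ≤ T by lia), Finset.sum_insert (by simp)]
  rw [sub_self, mul_zero, zero_add, mul_div_left_comm]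
  have : ∑ d ∈ Finset.Ico 1 T, (μ d : ℝ) / d * (Real.log T - Real.log d) =
      Real.log T * ∑ d ∈ Finset.Ico 1 T, (μ d : ℝ) / d -
        ∑ d ∈ Finset.Ico 1 T, (μ d : ℝ) * (Real.log d / d) := by
    rw [Finset.mul_sum, ← Finset.sum_sub_distrib]
    exact Finset.sum_congr rfl fun d _ => by ring
  rw [this]
  field_simp
  ring

theorem sum_Ico_moebius_div (T : ℕ) :
    ∑ j ∈ Finset.Ico 1 T, (μ j : ℝ) / j = moebiusSum ((T - 1 : ℕ) : ℝ) := by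
  rw [moebiusSum, Nat.floor_natCast]
  congr 1

theorem sum_abs_truncatedMoebius_le {T : ℕ} (hT : 0 < T) :
    ∑ d ∈ Finset.Icc 1 T, |truncatedMoebius T d| ≤ 3 * T - 1 := by
  rw [← Finset.Ico_insert_right (by lia), Finset.sum_insert (by simp), truncatedMoebius_self,
    sum_Ico_moebius_div T]
  have h1 : |-(T : ℝ) * moebiusSum ((T - 1 : ℕ) : ℝ)| ≤ T * 2 := by
    rw [abs_mul, abs_neg, Nat.abs_cast]
    gcongr
    exact abs_moebiusSum_le _
  have h2 : ∑ d ∈ Finset.Ico 1 T, |truncatedMoebius T d| ≤ ∑ d ∈ Finset.Ico 1 T, (1 : ℝ) := by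
    refine Finset.sum_le_sum fun d hd => ?_
    rw [truncatedMoebius_of_lt (Finset.mem_Ico.1 hd).2]
    exact abs_moebius_le_one_real d
  simp only [Finset.sum_const, Nat.card_Ico, nsmul_eq_mul, mul_one] at h2
  rw [Nat.cast_sub (by lia)] at h2
  push_cast at h2
  linarith

/-- Inserting S(y) = y log y - y + O(1 + log y), the part proportional to x log x - x is multiplied
by ∑ a(d)/d = 0. -/
theorem approxPsi_truncatedMoebius_isBigO {T : ℕ} (hT : 0 < T) :
    (fun x : ℝ => approxPsi (truncatedMoebius T) x -
      x * -(∑ d ∈ Finset.Icc 1 T, truncatedMoebius T d * Real.log (d : ℝ) / (d : ℝ)))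
      =O[atTop] Real.log := by
  refine IsBigO.of_bound (∑ d ∈ Finset.Icc 1 T, |truncatedMoebius T d| * 2) ?_
  -- x ≥ T brings in the whole support of the coefficients; x ≥ e gives 1 + log(x/d) ≤ 2 log x.
  filter_upwards [eventually_ge_atTop (T : ℝ), eventually_ge_atTop (Real.exp 1)] with x hx hx2
  have hx1 : (1 : ℝ) ≤ x := (by exact_mod_cast hT : (1 : ℝ) ≤ T).trans hx
  have hlog : 1 ≤ Real.log x := (Real.le_log_iff_exp_le (by linarith)).2 hx2
  have e : approxPsi (truncatedMoebius T) x -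
      x * -(∑ d ∈ Finset.Icc 1 T, truncatedMoebius T d * Real.log (d : ℝ) / (d : ℝ)) =
      ∑ d ∈ Finset.Icc 1 T, truncatedMoebius T d *
        (logSum (x / d) - (x / d * Real.log (x / d) - x / d)) := by
    rw [approxPsi, sum_Icc_truncatedMoebius_mul (Nat.le_floor hx)]
    have h1 : (x * Real.log x - x) * ∑ d ∈ Finset.Icc 1 T, truncatedMoebius T d / (d : ℝ) = 0 := by
      rw [sum_truncatedMoebius_div hT, mul_zero]
    rw [← sub_zero (_ - _), ← h1, Finset.mul_sum, mul_neg, Finset.mul_sum, sub_neg_eq_add,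
      ← Finset.sum_add_distrib, ← Finset.sum_sub_distrib]
    refine Finset.sum_congr rfl fun d hd => ?_
    have hd0 : (d : ℝ) ≠ 0 := by
      rw [Finset.mem_Icc] at hd
      exact_mod_cast (by lia : d ≠ 0)
    rw [Real.log_div (by linarith) hd0]
    ring
  rw [e, Real.norm_of_nonneg (by linarith : 0 ≤ Real.log x), Finset.sum_mul]
  refine (Finset.abs_sum_le_sum_abs _ _).trans (Finset.sum_le_sum fun d hd => ?_)
  rw [Finset.mem_Icc] at hd
  have hd1 : (1 : ℝ) ≤ d := by exact_mod_cast hd.1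
  have hdT : (d : ℝ) ≤ T := by exact_mod_cast hd.2
  have h1 : 1 ≤ x / d := (one_le_div (by linarith)).2 (hdT.trans hx)
  have h2 : Real.log (x / d) ≤ Real.log x :=
    Real.log_le_log (by linarith) (div_le_self (by linarith) hd1)
  rw [abs_mul, mul_assoc]
  gcongr
  linarith [abs_logSum_sub_le h1]

/-! ### The weights `E(t)` -/

theorem weightSum_truncatedMoebius_of_lt {T : ℕ} {t : ℝ} (h1 : 1 ≤ ⌊t⌋₊) (h : ⌊t⌋₊ < T) :
    weightSum (truncatedMoebius T) t = 1 := by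
  rw [weightSum_eq, ← sum_moebius_mul_div h1]
  refine Finset.sum_congr rfl fun d hd => ?_
  rw [Finset.mem_Icc] at hd
  rw [truncatedMoebius_of_lt (by lia)]

/-- Since ∑ a(d)/d = 0, each floor may be replaced by minus a fractional part, leaving ∑ |a(d)| ≤ 3T
- 1. -/
theorem abs_weightSum_truncatedMoebius_le {T : ℕ} {t : ℝ} (hT : 0 < T) (h : T ≤ ⌊t⌋₊) :
    |weightSum (truncatedMoebius T) t - 1| ≤ 3 * T := by
  have h0 : |weightSum (truncatedMoebius T) t| ≤ 3 * T - 1 := by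
    refine le_trans ?_ (sum_abs_truncatedMoebius_le hT)
    rw [weightSum_eq, sum_Icc_truncatedMoebius_mul h]
    generalize ⌊t⌋₊ = N
    have e : ∑ d ∈ Finset.Icc 1 T, truncatedMoebius T d * ((N / d : ℕ) : ℝ) =
        ∑ d ∈ Finset.Icc 1 T, truncatedMoebius T d * (((N / d : ℕ) : ℝ) - (N : ℝ) / d) := by
      have h1 : (N : ℝ) * ∑ d ∈ Finset.Icc 1 T, truncatedMoebius T d / (d : ℝ) = 0 := by
        rw [sum_truncatedMoebius_div hT, mul_zero]
      rw [← sub_zero (∑ d ∈ Finset.Icc 1 T, truncatedMoebius T d * ((N / d : ℕ) : ℝ)), ← h1,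
        Finset.mul_sum, ← Finset.sum_sub_distrib]
      exact Finset.sum_congr rfl fun d _ => by ring
    rw [e]
    refine (Finset.abs_sum_le_sum_abs _ _).trans (Finset.sum_le_sum fun d _ => ?_)
    rw [abs_mul]
    refine mul_le_of_le_one_right (abs_nonneg _) ?_
    rw [← Nat.floor_div_eq_div (K := ℝ), abs_le]
    have h3 := Nat.floor_le (show (0 : ℝ) ≤ (N : ℝ) / d by positivity)
    have h4 := Nat.lt_floor_add_one ((N : ℝ) / d)
    constructor <;> linarith
  have := abs_sub (weightSum (truncatedMoebius T) t) 1
  rw [abs_one] at this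
  linarith

/-- The quotient N/d counts the k with kd ≤ N. For d ≥ T and N ≤ KT this forces k ≤ K, so only K
blocks of μ occur. -/
theorem sum_Icc_moebius_mul_div_eq {T N K : ℕ} (hT : 0 < T) (hN : N ≤ K * T) :
    ∑ d ∈ Finset.Icc T N, (μ d : ℝ) * ((N / d : ℕ) : ℝ) =
      ∑ k ∈ Finset.Icc 1 K, ∑ d ∈ Finset.Icc T (N / k), (μ d : ℝ) := by
  have h1 : ∀ d ∈ Finset.Icc T N, (μ d : ℝ) * ((N / d : ℕ) : ℝ) =
      ∑ k ∈ Finset.Icc 1 K with k * d ≤ N, (μ d : ℝ) := by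
    intro d hd
    rw [Finset.mem_Icc] at hd
    have : (Finset.Icc 1 K).filter (fun k => k * d ≤ N) = Finset.Icc 1 (N / d) := by
      ext k
      simp only [Finset.mem_filter, Finset.mem_Icc]
      rw [Nat.le_div_iff_mul_le (by lia)]
      refine ⟨fun h => ⟨h.1.1, h.2⟩, fun h => ⟨⟨h.1, ?_⟩, h.2⟩⟩
      have : k * T ≤ K * T := (Nat.mul_le_mul_left k hd.1).trans (h.2.trans hN)
      exact Nat.le_of_mul_le_mul_right this hT
    rw [this, Finset.sum_const, Nat.card_Icc, Nat.add_sub_cancel, nsmul_eq_mul, mul_comm]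
  rw [Finset.sum_congr rfl h1]
  simp_rw [Finset.sum_filter]
  rw [Finset.sum_comm]
  refine Finset.sum_congr rfl fun k hk => ?_
  rw [Finset.mem_Icc] at hk
  rw [← Finset.sum_filter]
  refine Finset.sum_congr ?_ fun _ _ => rfl
  ext d
  simp only [Finset.mem_filter, Finset.mem_Icc]
  rw [Nat.le_div_iff_mul_le (by lia), mul_comm d k]
  refine ⟨fun h => ⟨h.1.1, h.2⟩, fun h => ⟨⟨h.1, ?_⟩, h.2⟩⟩
  exact (Nat.le_mul_of_pos_left d (by lia)).trans h.2

/-- By ∑ μ(d)⌊N/d⌋ = 1, the deviation from 1 is the missing tail d ≥ T plus the coefficient at T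
times its floor. The tail is K differences of Mertens sums, each at most 2ηKT. -/
theorem abs_weightSum_truncatedMoebius_sub_one_le {T K : ℕ} {t η γ : ℝ} (hT : 0 < T) (hη : 0 ≤ η)
    (hM : ∀ m : ℕ, T ≤ m + 1 → |∑ d ∈ Finset.Icc 1 m, (μ d : ℝ)| ≤ η * m)
    (hγ : |∑ j ∈ Finset.Ico 1 T, (μ j : ℝ) / j| ≤ γ) (h : T ≤ ⌊t⌋₊) (hK : ⌊t⌋₊ ≤ K * T) :
    |weightSum (truncatedMoebius T) t - 1| ≤ (2 * η * K ^ 2 + K * γ) * T := by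
  have hT' : (0 : ℝ) < T := by exact_mod_cast hT
  rw [weightSum_eq, sum_Icc_truncatedMoebius_mul h]
  generalize ⌊t⌋₊ = N at *
  rw [sum_truncatedMoebius_mul hT]
  have hsplit : ∑ d ∈ Finset.Ico 1 T, (μ d : ℝ) * ((N / d : ℕ) : ℝ) +
      ∑ d ∈ Finset.Icc T N, (μ d : ℝ) * ((N / d : ℕ) : ℝ) = 1 := by
    rw [← sum_moebius_mul_div (show 1 ≤ N by lia), ← Finset.Ico_add_one_right_eq_Icc,
      ← Finset.Ico_add_one_right_eq_Icc, Finset.sum_Ico_consecutive _ (by lia) (by lia)]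
  rw [sum_Icc_moebius_mul_div_eq hT hK] at hsplit
  have hNK : (N : ℝ) ≤ K * T := by exact_mod_cast hK
  have hinner : ∀ k ∈ Finset.Icc 1 K, |∑ d ∈ Finset.Icc T (N / k), (μ d : ℝ)| ≤
      2 * η * K * T := by
    intro k hk
    rw [Finset.mem_Icc] at hk
    rcases Nat.lt_or_ge (N / k) T with hlt | hge
    · rw [Finset.Icc_eq_empty (by lia), Finset.sum_empty, abs_zero]
      positivity
    · have e : ∑ d ∈ Finset.Icc T (N / k), (μ d : ℝ) =
          ∑ d ∈ Finset.Icc 1 (N / k), (μ d : ℝ) - ∑ d ∈ Finset.Icc 1 (T - 1), (μ d : ℝ) := by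
        rw [eq_sub_iff_add_eq, add_comm, ← Finset.Ico_add_one_right_eq_Icc,
          ← Finset.Ico_add_one_right_eq_Icc, ← Finset.Ico_add_one_right_eq_Icc,
          show T - 1 + 1 = T by lia, Finset.sum_Ico_consecutive _ (by lia) (by lia)]
      have h1 := hM (N / k) (by lia)
      -- The lower end of each block requires the Mertens bound at T - 1, hence the form T ≤ m + 1
      -- of `hM`.
      have h2 := hM (T - 1) (by lia)
      have h3 : ((N / k : ℕ) : ℝ) ≤ N := by exact_mod_cast Nat.div_le_self N k
      have h4 : ((T - 1 : ℕ) : ℝ) ≤ N := by exact_mod_cast (by lia : T - 1 ≤ N)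
      rw [e]
      refine (abs_sub _ _).trans ?_
      calc _ ≤ η * N + η * N := by
            refine add_le_add (h1.trans ?_) (h2.trans ?_) <;> gcongr
        _ ≤ η * (K * T) + η * (K * T) := by gcongr
        _ = _ := by ring
  have hsum : |∑ k ∈ Finset.Icc 1 K, ∑ d ∈ Finset.Icc T (N / k), (μ d : ℝ)| ≤
      K * (2 * η * K * T) := by
    refine (Finset.abs_sum_le_sum_abs _ _).trans ((Finset.sum_le_sum hinner).trans ?_)
    simp
  have hlast : |T * (∑ j ∈ Finset.Ico 1 T, (μ j : ℝ) / j) * ((N / T : ℕ) : ℝ)| ≤ T * γ * K := by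
    rw [abs_mul, abs_mul, Nat.abs_cast, Nat.abs_cast]
    have hdiv : ((N / T : ℕ) : ℝ) ≤ K := by
      exact_mod_cast Nat.div_le_of_le_mul (by rw [mul_comm]; exact hK)
    have : 0 ≤ γ := (abs_nonneg _).trans hγ
    gcongr
  have e : ∑ d ∈ Finset.Ico 1 T, (μ d : ℝ) * ((N / d : ℕ) : ℝ) -
      T * (∑ j ∈ Finset.Ico 1 T, (μ j : ℝ) / j) * ((N / T : ℕ) : ℝ) - 1 =
      -(∑ k ∈ Finset.Icc 1 K, ∑ d ∈ Finset.Icc T (N / k), (μ d : ℝ) +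
        T * (∑ j ∈ Finset.Ico 1 T, (μ j : ℝ) / j) * ((N / T : ℕ) : ℝ)) := by
    linarith
  rw [e, abs_neg]
  refine (abs_add_le _ _).trans ((add_le_add hsum hlast).trans (le_of_eq ?_))
  ring

theorem sum_vonMangoldt_indicator_le (x : ℝ) {y c : ℝ} (hc : 0 ≤ c) (hy : 0 ≤ y) :
    ∑ l ∈ Finset.Icc 1 ⌊x⌋₊, Λ l * (if (l : ℝ) ≤ y then c else 0) ≤
      c * ((Real.log 4 + 4) * y) := by
  have h1 := Chebyshev.psi_le_const_mul_self hy
  refine le_trans ?_ (mul_le_mul_of_nonneg_left h1 hc)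
  rw [Chebyshev.psi, ← Icc_one_eq_Ioc_zero, Finset.mul_sum]
  simp_rw [mul_ite, mul_zero]
  rw [← Finset.sum_filter]
  simp_rw [mul_comm _ c]
  refine Finset.sum_le_sum_of_subset_of_nonneg ?_ fun l _ _ =>
    mul_nonneg hc ArithmeticFunction.vonMangoldt_nonneg
  intro l hl
  simp only [Finset.mem_filter, Finset.mem_Icc] at hl ⊢
  exact ⟨hl.1.1, Nat.le_floor hl.2⟩

/-- A term is nonzero only for l ≤ x/T, and the crude bound 3T is needed only for l ≤ x/(KT).
Chebyshev's bound for ψ at these two points cancels the factor T. -/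
theorem remainder_truncatedMoebius_le {T K : ℕ} {η γ x : ℝ} (hT : 0 < T) (hK : 0 < K)
    (hη : 0 ≤ η) (hM : ∀ m : ℕ, T ≤ m + 1 → |∑ d ∈ Finset.Icc 1 m, (μ d : ℝ)| ≤ η * m)
    (hγ : |∑ j ∈ Finset.Ico 1 T, (μ j : ℝ) / j| ≤ γ) (hx : 0 ≤ x) :
    remainder (truncatedMoebius T) x ≤
      (Real.log 4 + 4) * (2 * η * K ^ 2 + K * γ + 3 / K) * x := by
  have hT' : (0 : ℝ) < T := by exact_mod_cast hT
  have hK' : (0 : ℝ) < K := by exact_mod_cast hK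
  have hγ0 : 0 ≤ γ := (abs_nonneg _).trans hγ
  set B : ℝ := (2 * η * K ^ 2 + K * γ) * T with hB
  have hB0 : 0 ≤ B := by positivity
  have h1 := sum_vonMangoldt_indicator_le x hB0 (show 0 ≤ x / T by positivity)
  have h2 := sum_vonMangoldt_indicator_le x (show (0 : ℝ) ≤ 3 * T by positivity)
    (show 0 ≤ x / (K * T) by positivity)
  have h3 : remainder (truncatedMoebius T) x ≤
      ∑ l ∈ Finset.Icc 1 ⌊x⌋₊, Λ l * (if (l : ℝ) ≤ x / T then B else 0) +
        ∑ l ∈ Finset.Icc 1 ⌊x⌋₊, Λ l * (if (l : ℝ) ≤ x / (K * T) then 3 * (T : ℝ) else 0) := by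
    rw [remainder, ← Finset.sum_add_distrib]
    refine Finset.sum_le_sum fun l hl => ?_
    rw [← mul_add]
    refine mul_le_mul_of_nonneg_left ?_ ArithmeticFunction.vonMangoldt_nonneg
    rw [Finset.mem_Icc] at hl
    have hl0 : (0 : ℝ) < l := by exact_mod_cast (by lia : 0 < l)
    have hi1 : 0 ≤ if (l : ℝ) ≤ x / T then B else 0 := by split_ifs <;> positivity
    have hi2 : 0 ≤ if (l : ℝ) ≤ x / (K * T) then 3 * (T : ℝ) else 0 := by split_ifs <;> positivity
    have hfl : 1 ≤ ⌊x / l⌋₊ := by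
      rw [Nat.one_le_floor_iff, one_le_div hl0]
      exact (Nat.le_floor_iff hx).1 hl.2
    rcases Nat.lt_or_ge ⌊x / l⌋₊ T with hlt | hge
    · rw [weightSum_truncatedMoebius_of_lt hfl hlt, sub_self, abs_zero]
      positivity
    · rcases Nat.lt_or_ge (K * T) ⌊x / l⌋₊ with hlt' | hle
      · have h4 : (l : ℝ) ≤ x / (K * T) := by
          have := (Nat.le_floor_iff (show 0 ≤ x / l by positivity)).1 hlt'.le
          rw [le_div_iff₀ hl0] at this
          rw [le_div_iff₀ (by positivity)]
          push_cast at this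
          linarith
        rw [if_pos h4]
        linarith [abs_weightSum_truncatedMoebius_le hT hge]
      · have h4 : (l : ℝ) ≤ x / T := by
          have := (Nat.le_floor_iff (show 0 ≤ x / l by positivity)).1 hge
          rw [le_div_iff₀ hl0] at this
          rw [le_div_iff₀ hT']
          linarith
        rw [if_pos h4]
        linarith [abs_weightSum_truncatedMoebius_sub_one_le hT hη hM hγ hge hle]
  refine h3.trans ((add_le_add h1 h2).trans (le_of_eq ?_))
  rw [hB]
  field_simp

end Method
-- From ψ to π, and the choice of parameters.
section PrimeCounting

open Topology
open scoped ArithmeticFunction.Moebius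

/-- Both comparisons pass through θ: after normalisation, π against θ/log x costs O(1/log x) and ψ
against θ costs O(x^(-1/2)). -/
theorem tendsto_primeCounting_sub_psi :
    Tendsto (fun x : ℝ => (Nat.primeCounting ⌊x⌋₊ : ℝ) / (x / Real.log x) - Chebyshev.psi x / x)
      atTop (𝓝 0) := by
  have h1 : Tendsto (fun x : ℝ => ((Nat.primeCounting ⌊x⌋₊ : ℝ) -
      Chebyshev.theta x / Real.log x) * (Real.log x / x)) atTop (𝓝 0) := by
    refine (Chebyshev.primeCounting_sub_theta_div_log_isBigO.mul
      (isBigO_refl (fun x : ℝ => Real.log x / x) atTop)).trans_tendsto ?_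
    refine (tendsto_inv_atTop_zero.comp Real.tendsto_log_atTop).congr' ?_
    filter_upwards [eventually_gt_atTop 1] with x hx
    have := Real.log_pos hx
    simp only [Function.comp]
    field_simp
  have h2 : Tendsto (fun x : ℝ => (Chebyshev.psi x - Chebyshev.theta x) * x⁻¹) atTop (𝓝 0) := by
    refine (Chebyshev.isBigO_psi_sub_theta_sqrt.mul
      (isBigO_refl (fun x : ℝ => x⁻¹) atTop)).trans_tendsto ?_
    refine (tendsto_inv_atTop_zero.comp Real.tendsto_sqrt_atTop).congr' ?_
    filter_upwards [eventually_gt_atTop 0] with x hx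
    simp only [Function.comp]
    have h3 := Real.sqrt_pos.2 hx
    field_simp
    exact (Real.sq_sqrt hx.le).symm
  have h3 := h1.sub h2
  rw [sub_zero] at h3
  refine h3.congr' ?_
  filter_upwards [eventually_gt_atTop 1] with x hx
  have := Real.log_pos hx
  field_simp
  ring

theorem primeCountingError_le_errorBound (a : ℕ → ℝ) :
    primeCountingError ≤ errorBound a := by
  set u : ℝ → EReal := fun x => ((|approxPsi a x / x - 1| : ℝ) : EReal) with hu
  set v : ℝ → EReal := fun x => ((remainder a x / x : ℝ) : EReal) with hv
  set w : ℝ → EReal := fun x => ((|(Nat.primeCounting ⌊x⌋₊ : ℝ) / (x / Real.log x) -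
    Chebyshev.psi x / x| : ℝ) : EReal) with hw
  have hw0 : limsup w atTop = 0 := by
    refine Tendsto.limsup_eq ?_
    have := tendsto_primeCounting_sub_psi.abs
    rw [abs_zero] at this
    exact (EReal.tendsto_coe).2 this
  have hu0 : 0 ≤ limsup u atTop := by
    refine le_limsup_of_frequently_le (Eventually.frequently (Eventually.of_forall fun x => ?_))
    exact EReal.coe_nonneg.2 (abs_nonneg _)
  have hv0 : 0 ≤ limsup v atTop := by
    refine le_limsup_of_frequently_le (Eventually.frequently ?_)
    filter_upwards [eventually_gt_atTop 0] with x hx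
    exact EReal.coe_nonneg.2 (div_nonneg (remainder_nonneg a x) hx.le)
  -- Subadditivity of limsup in `EReal` requires ruling out ⊤ + ⊥; the limsups may be ⊤ but not ⊥.
  have hne : ∀ {y : EReal}, 0 ≤ y → y ≠ ⊥ := fun h => (EReal.bot_lt_zero.trans_le h).ne'
  have huv : limsup (u + v) atTop ≤ limsup u atTop + limsup v atTop :=
    EReal.limsup_add_le (.inl (hne hu0)) (.inr (hne hv0))
  have huvw : limsup (w + (u + v)) atTop ≤ limsup w atTop + limsup (u + v) atTop :=
    EReal.limsup_add_le (.inl (by simp [hw0])) (.inl (by simp [hw0]))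
  rw [hw0, zero_add] at huvw
  refine le_trans ?_ (huvw.trans huv)
  refine limsup_le_limsup ?_
  filter_upwards [eventually_gt_atTop 0] with x hx
  simp only [Pi.add_apply, hu, hv, hw]
  rw [← EReal.coe_add, ← EReal.coe_add, EReal.coe_le_coe_iff]
  have h1 := abs_psi_sub_le a x
  have h2 : |Chebyshev.psi x / x - 1| ≤ |approxPsi a x / x - 1| + remainder a x / x := by
    rw [div_sub_one hx.ne', div_sub_one hx.ne', abs_div, abs_div, abs_of_pos hx, ← add_div]
    gcongr
  have h3 := abs_sub_le ((Nat.primeCounting ⌊x⌋₊ : ℝ) / (x / Real.log x)) (Chebyshev.psi x / x) 1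
  linarith

theorem limsup_approxPsi_truncatedMoebius {T : ℕ} (hT : 0 < T) :
    limsup (fun x : ℝ => ((|approxPsi (truncatedMoebius T) x / x - 1| : ℝ) : EReal)) atTop =
      ((|-(∑ d ∈ Finset.Icc 1 T,
        truncatedMoebius T d * Real.log (d : ℝ) / (d : ℝ)) - 1| : ℝ) : EReal) := by
  refine Tendsto.limsup_eq ((EReal.tendsto_coe).2 (Tendsto.abs (Tendsto.sub_const ?_ 1)))
  have h1 := ((approxPsi_truncatedMoebius_isBigO hT).trans_isLittleO
    Real.isLittleO_log_id_atTop).tendsto_div_nhds_zero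
  have h2 := h1.add_const (-(∑ d ∈ Finset.Icc 1 T,
    truncatedMoebius T d * Real.log (d : ℝ) / (d : ℝ)))
  rw [zero_add] at h2
  refine h2.congr' ?_
  filter_upwards [eventually_gt_atTop 0] with x hx
  simp only [id]
  field_simp
  ring

theorem eventually_remainder_truncatedMoebius_le {δ : ℝ} (hδ : 0 < δ) :
    ∀ᶠ T : ℕ in atTop, ∀ x : ℝ, 0 < x → remainder (truncatedMoebius T) x / x ≤ δ := by
  set c : ℝ := Real.log 4 + 4 with hc
  have hc0 : 0 < c := by positivity
  -- K makes the far range cost at most δ/3; η and γ, chosen in terms of K, make the other two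
  -- contributions δ/3 each.
  obtain ⟨K, hK⟩ := exists_nat_gt (9 * c / δ)
  have hK0' : (0 : ℝ) < K := (by positivity : (0 : ℝ) < 9 * c / δ).trans hK
  have hK0 : 0 < K := by exact_mod_cast hK0'
  rw [div_lt_iff₀ hδ] at hK
  set η : ℝ := δ / (6 * c * K ^ 2) with hη
  set γ : ℝ := δ / (3 * c * K) with hγ
  have hη0 : 0 < η := by positivity
  have hγ0 : 0 < γ := by positivity
  have hM := (tendsto_mertens_div.abs).eventually_lt_const (show |(0 : ℝ)| < η by simpa using hη0)
  obtain ⟨m₀, hm₀⟩ := eventually_atTop.1 hM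
  have hg : ∀ᶠ T : ℕ in atTop, |moebiusSum ((T - 1 : ℕ) : ℝ)| < γ :=
    ((tendsto_moebiusSum.comp (tendsto_natCast_atTop_atTop.comp
      (tendsto_sub_atTop_nat 1))).abs).eventually_lt_const (by simpa using hγ0)
  -- With T > m₀ + 1, every m ≥ T - 1 is both beyond m₀ and positive, so the bound on M(m)/m can be
  -- cleared of its denominator.
  filter_upwards [hg, eventually_gt_atTop (m₀ + 1)] with T hgT hT x hx
  have h := remainder_truncatedMoebius_le (T := T) (K := K) (η := η) (γ := γ) (by lia) hK0
    hη0.le (fun m hm => ?_) (by rw [sum_Ico_moebius_div]; exact hgT.le) hx.le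
  · rw [div_le_iff₀ hx]
    refine h.trans (mul_le_mul_of_nonneg_right ?_ hx.le)
    have e : c * (2 * η * K ^ 2 + K * γ + 3 / K) = δ / 3 + δ / 3 + 3 * c / K := by
      rw [hη, hγ]
      field_simp
      ring
    have h3 : 3 * c / K ≤ δ / 3 := by
      rw [div_le_div_iff₀ hK0' (by norm_num)]
      linarith
    linarith
  · have h1 := (hm₀ m (by lia)).le
    have hm0 : (0 : ℝ) < m := by exact_mod_cast (by lia : 0 < m)
    rwa [abs_div, Nat.abs_cast, div_le_iff₀ hm0] at h1

end PrimeCounting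
end ChebyshevMethod

theorem theorem4p1 (ε : ℝ) (hε : 0 < ε) :
    ∃ T : ℕ, 0 < T ∧
      -- the coefficients satisfy Chebyshev's two conditions
      (∑ d ∈ Finset.Icc 1 T, ChebyshevMethod.truncatedMoebius T d / (d : ℝ) = 0) ∧
      |-(∑ d ∈ Finset.Icc 1 T,
          ChebyshevMethod.truncatedMoebius T d * Real.log (d : ℝ) / (d : ℝ)) - 1| < ε ∧
      -- the main term of the approximation
      ((fun x : ℝ => ChebyshevMethod.approxPsi (ChebyshevMethod.truncatedMoebius T) x -
          x * -(∑ d ∈ Finset.Icc 1 T,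
            ChebyshevMethod.truncatedMoebius T d * Real.log (d : ℝ) / (d : ℝ)))
        =O[Filter.atTop] Real.log) ∧
      -- comparison of the approximation with `ψ`
      (∀ x : ℝ, 1 ≤ x →
        ChebyshevMethod.approxPsi (ChebyshevMethod.truncatedMoebius T) x =
          ∑ l ∈ Finset.Icc 1 ⌊x⌋₊, ArithmeticFunction.vonMangoldt l *
            ChebyshevMethod.weightSum (ChebyshevMethod.truncatedMoebius T) (x / (l : ℝ))) ∧
      (∀ x : ℝ, 1 ≤ x →
        |Chebyshev.psi x - x| ≤
          |ChebyshevMethod.approxPsi (ChebyshevMethod.truncatedMoebius T) x - x| +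
            ChebyshevMethod.remainder (ChebyshevMethod.truncatedMoebius T) x) ∧
      -- the resulting bounds
      ChebyshevMethod.primeCountingError ≤
        ChebyshevMethod.errorBound (ChebyshevMethod.truncatedMoebius T) ∧
      ChebyshevMethod.errorBound (ChebyshevMethod.truncatedMoebius T) < (ε : EReal) ∧
      ChebyshevMethod.primeCountingError < (ε : EReal) := by
  have hA : ∀ᶠ T : ℕ in Filter.atTop, |ChebyshevMethod.moebiusLogSum (Real.log T) - 1| < ε / 2 := by
    have := ((ChebyshevMethod.tendsto_moebiusLogSum.comp (Real.tendsto_log_atTop.comp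
      tendsto_natCast_atTop_atTop)).sub_const 1).abs
    rw [sub_self, abs_zero] at this
    exact this.eventually_lt_const (half_pos hε)
  -- The main term is allotted ε/2 and the remainder ε/4, so their sum stays strictly below ε.
  obtain ⟨T, hT, hA, hR⟩ := ((Filter.eventually_gt_atTop 0).and (hA.and
    (ChebyshevMethod.eventually_remainder_truncatedMoebius_le
      (show 0 < ε / 4 by positivity)))).exists
  rw [← ChebyshevMethod.neg_sum_truncatedMoebius_mul_log hT] at hA
  have hle := ChebyshevMethod.primeCountingError_le_errorBound (ChebyshevMethod.truncatedMoebius T)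
  have hlt : ChebyshevMethod.errorBound (ChebyshevMethod.truncatedMoebius T) < (ε : EReal) := by
    have h1 : Filter.limsup (fun x : ℝ =>
        ((ChebyshevMethod.remainder (ChebyshevMethod.truncatedMoebius T) x / x : ℝ) : EReal))
        Filter.atTop ≤ ((ε / 4 : ℝ) : EReal) := by
      refine Filter.limsup_le_of_le (h := ?_)
      filter_upwards [Filter.eventually_gt_atTop 0] with x hx
      exact EReal.coe_le_coe_iff.2 (hR x hx)
    rw [ChebyshevMethod.errorBound, ChebyshevMethod.limsup_approxPsi_truncatedMoebius hT]
    refine (add_le_add le_rfl h1).trans_lt ?_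
    rw [← EReal.coe_add, EReal.coe_lt_coe_iff]
    linarith
  exact ⟨T, hT, ChebyshevMethod.sum_truncatedMoebius_div hT, by linarith,
    ChebyshevMethod.approxPsi_truncatedMoebius_isBigO hT,
    fun x _ => ChebyshevMethod.approxPsi_eq_sum_vonMangoldt _ x,
    fun x _ => ChebyshevMethod.abs_psi_sub_le _ x, hle, hlt, hle.trans_lt hlt⟩
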